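/- All Lie (super)algebras are over $\mathbb{C}$. Let $\mathfrak g=\mathfrak g_0\oplus\mathfrak g_1$ be one of the Lie superalgebras $\mathfrak{osp}(m,n)$ with $m\ge 3$ ($n$ even), $G(3)$ or $F(4)$. Then $\mathfrak g_0=\mathfrak g^1\times\mathfrak g^2$ and $\mathfrak g_1=V_1\otimes V_2$, where $V_i$ is a $\mathfrak g^i$-module, as follows: for $\mathfrak{osp}(m,n)$, $\mathfrak g^1=\mathfrak{so}(m)$, $\mathfrak g^2=\mathfrak{sp}(n)$, and $V_1=\mathbb{C}^m$, $V_2=\mathbb{C}^n$ are the natural modules; for $G(3)$, $\mathfrak g^1$ is the exceptional simple Lie algebra $\mathfrak g_2$, $V_1$ is its $7$-dimensional simple module, $\mathfrak g^2=\mathfrak{sl}(2)$ and $V_2=\mathbb{C}^2$; for $F(4)$, $\mathfrak g^1=\mathfrak{so}(7)$, $V_1$ is its $8$-dimensional spin representation, $\mathfrak g^2=\mathfrak{sl}(2)$ and $V_2=\mathbb{C}^2$. Fix a nondegenerate invariant bilinear form on $\mathfrak g_0$ and use it to view the elements of the symmetric algebra $S(\mathfrak g_0)$ as polynomial functions on $\mathfrak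 g_0$. For a prime ideal $q$ of $S(\mathfrak g_0)$ let $F_q$ be the fraction field of $S(\mathfrak g_0)/q$, and let $k(q)$ be the rank of the symmetric $F_q$-bilinear form on $\mathfrak g_1\otimes F_q$ that extends the bracket $\mathfrak g_1\times\mathfrak g_1\to\mathfrak g_0\subset S(\mathfrak g_0)$; that is, the rank over $F_q$ of the matrix $([v_i,v_j])$, where $(v_i)$ is any basis of $\mathfrak g_1$. If the ideal $q$ of all elements of $S(\mathfrak g_0)$ that vanish on $\mathcal O\subseteq\mathfrak g_0$ is prime, write $k(\mathcal O)=k(q)$. For a partition $\mu=(\mu_1\ge\mu_2\ge\cdots)$ put $\mu'_i=\#\{j:\mu_j\ge i\}$. **Theorem.** Let $\mathcal O_{\mu,\nu}\subseteq\mathfrak g_0$ be the orbit, under the adjoint group of $\mathfrak g_0$, of an element $(x,y)\in\mathfrak g^1\times\mathfrak g^2$ such that $x$ acts on $V_1$ and $y$ acts on $V_2$ as nilpotent endomorphisms whose Jordan blocks have the sizes given by the partitions $\mu$ of $\dim V_1$ and $\nu$ of $\dim V_2$, respectively. Then the ideal of $\mathcal O_{\mu,\nu}$ in $S(\mathfrak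 g_0)$ is prime, and $$k(\mathcal O_{\mu,\nu})=\dim\mathfrak g_1-\sum_{i\ge 1}\mu'_i\,\nu'_i .$$ -/

import Mathlib

open scoped TensorProduct

attribute [local instance 100] LieRing.ofAssociativeRing

/-! ### Lie superalgebras -/

/-- A Lie superalgebra structure over `ℂ` on `𝔤₀ ⊕ 𝔤₁`: the even part `𝔤₀` is a Lie algebra, the
odd part `𝔤₁` is a representation of `𝔤₀`, and there is a symmetric `𝔤₀`-equivariant bracket
`𝔤₁ × 𝔤₁ → 𝔤₀` satisfying the Jacobi identity on odd elements. -/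
structure LieSuperalgebra (𝔤₀ 𝔤₁ : Type*) [LieRing 𝔤₀] [LieAlgebra ℂ 𝔤₀]
    [AddCommGroup 𝔤₁] [Module ℂ 𝔤₁] where
  /-- the bracket `𝔤₀ × 𝔤₁ → 𝔤₁` -/
  act : 𝔤₀ →ₗ⁅ℂ⁆ Module.End ℂ 𝔤₁
  /-- the bracket `𝔤₁ × 𝔤₁ → 𝔤₀` -/
  bracket : 𝔤₁ →ₗ[ℂ] 𝔤₁ →ₗ[ℂ] 𝔤₀
  bracket_symm : ∀ a b, bracket a b = bracket b a
  lie_bracket : ∀ x a b, ⁅x, bracket a b⁆ = bracket (act x a) b + bracket a (act x b)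
  jacobi : ∀ a b c,
    act (bracket a b) c + act (bracket b c) a + act (bracket c a) b = 0

section Clifford

variable {𝔤₀ 𝔤₁ : Type*} [LieRing 𝔤₀] [LieAlgebra ℂ 𝔤₀] [AddCommGroup 𝔤₁] [Module ℂ 𝔤₁]

/-- The matrix `M(𝔤) = ([v_i, v_j])` with entries in `S(𝔤₀)`, for a basis `v` of `𝔤₁`. -/
noncomputable def LieSuperalgebra.bracketMatrix (𝔤 : LieSuperalgebra 𝔤₀ 𝔤₁) {ι : Type*}
    (v : Module.Basis ι ℂ 𝔤₁) : Matrix ι ι (SymmetricAlgebra ℂ 𝔤₀) :=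
  Matrix.of fun i j => SymmetricAlgebra.ι ℂ 𝔤₀ (𝔤.bracket (v i) (v j))

/-- `k(q)`: the rank of the bilinear form on `𝔤₁ ⊗ F_q` that extends the bracket of `𝔤₁`, where
`F_q` is the fraction field of `S(𝔤₀)/q`. In the basis `v` of `𝔤₁`, the matrix of this form is the
image of `M(𝔤)`. -/
noncomputable def LieSuperalgebra.formRank (𝔤 : LieSuperalgebra 𝔤₀ 𝔤₁) {ι : Type*} [Fintype ι]
    (v : Module.Basis ι ℂ 𝔤₁) (q : Ideal (SymmetricAlgebra ℂ 𝔤₀)) : ℕ :=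
  ((𝔤.bracketMatrix v).map
    (algebraMap (SymmetricAlgebra ℂ 𝔤₀) (FractionRing (SymmetricAlgebra ℂ 𝔤₀ ⧸ q)))).rank

/-- The value at `z ∈ 𝔤₀` of an element of `S(𝔤₀)`, viewed as a polynomial function on `𝔤₀` by
means of the bilinear form `Φ`: an element `a` of `𝔤₀` is the function `z ↦ Φ z a`. -/
noncomputable def evalAt (Φ : LinearMap.BilinForm ℂ 𝔤₀) (z : 𝔤₀) :
    SymmetricAlgebra ℂ 𝔤₀ →ₐ[ℂ] ℂ :=
  SymmetricAlgebra.lift (Φ z)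

/-- The ideal of all elements of `S(𝔤₀)` that vanish on `O ⊆ 𝔤₀`. -/
noncomputable def idealOfSet (Φ : LinearMap.BilinForm ℂ 𝔤₀) (O : Set 𝔤₀) :
    Ideal (SymmetricAlgebra ℂ 𝔤₀) :=
  ⨅ z ∈ O, RingHom.ker (evalAt Φ z)

end Clifford

/-! ### Nilpotent orbits and Jordan types -/

/-- The adjoint group of a semisimple complex Lie algebra: the group generated by all
`exp (ad n)`, where `ad n` is nilpotent. -/
def adjointGroup (𝔨 : Type*) [LieRing 𝔨] [LieAlgebra ℂ 𝔨] : Subgroup (𝔨 ≃ₗ[ℂ] 𝔨) :=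
  Subgroup.closure {e | ∃ (n : 𝔨) (N : ℕ), (LieAlgebra.ad ℂ 𝔨 n) ^ N = 0 ∧
    ∀ z, e z = ∑ k ∈ Finset.range N, (k.factorial : ℂ)⁻¹ • ((LieAlgebra.ad ℂ 𝔨 n) ^ k) z}

/-- The orbit of `z` under the adjoint group. -/
def adjointOrbit {𝔨 : Type*} [LieRing 𝔨] [LieAlgebra ℂ 𝔨] (z : 𝔨) : Set 𝔨 :=
  {w | ∃ e ∈ adjointGroup 𝔨, e z = w}

/-- `T` is nilpotent with Jordan blocks of sizes `μ₁, μ₂, …`: there is a basis, indexed by the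
pairs of a block `i` and a position `j < s i` in it, such that `T` sends the first vector of every
block to `0` and every other basis vector to its predecessor. -/
def HasJordanType {V : Type*} [AddCommGroup V] [Module ℂ V] (T : Module.End ℂ V) {m : ℕ}
    (μ : m.Partition) : Prop :=
  ∃ (r : ℕ) (s : Fin r → ℕ) (b : Module.Basis (Σ i, Fin (s i)) ℂ V),
    Finset.univ.val.map s = μ.parts ∧
    (∀ (i : Fin r) (h : 0 < s i), T (b ⟨i, ⟨0, h⟩⟩) = 0) ∧
    ∀ (i : Fin r) (j : ℕ) (h : j + 1 < s i),
      T (b ⟨i, ⟨j + 1, h⟩⟩) = b ⟨i, ⟨j, Nat.lt_of_succ_lt h⟩⟩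

/-- The part `μ'_i = #{j | μ_j ≥ i}` of the dual partition. -/
def Nat.Partition.dualPart {m : ℕ} (μ : m.Partition) (i : ℕ) : ℕ :=
  (μ.parts.filter fun a => i ≤ a).card

/-! ### Lie superalgebras with `𝔤₀ = 𝔨₁ × 𝔨₂` and `𝔤₁ = V₁ ⊗ V₂` -/

/-- The data from which a Lie superalgebra with even part `𝔨₁ × 𝔨₂` and odd part `V₁ ⊗ V₂` is
built: representations `V₁`, `V₂` of `𝔨₁`, `𝔨₂`, invariant bilinear forms `ψ₁` (symmetric) and
`ψ₂` (skew-symmetric), and equivariant bilinear maps `π₁ : V₁ × V₁ → 𝔨₁` (skew-symmetric) and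
`π₂ : V₂ × V₂ → 𝔨₂` (symmetric), such that the product `LieSuperData.oddBracket` below satisfies
the Jacobi identity. -/
structure LieSuperData (𝔨₁ 𝔨₂ V₁ V₂ : Type*) [LieRing 𝔨₁] [LieAlgebra ℂ 𝔨₁]
    [LieRing 𝔨₂] [LieAlgebra ℂ 𝔨₂] [AddCommGroup V₁] [Module ℂ V₁]
    [AddCommGroup V₂] [Module ℂ V₂] where
  ρ₁ : 𝔨₁ →ₗ⁅ℂ⁆ Module.End ℂ V₁
  ρ₂ : 𝔨₂ →ₗ⁅ℂ⁆ Module.End ℂ V₂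
  ψ₁ : LinearMap.BilinForm ℂ V₁
  ψ₂ : LinearMap.BilinForm ℂ V₂
  π₁ : V₁ →ₗ[ℂ] V₁ →ₗ[ℂ] 𝔨₁
  π₂ : V₂ →ₗ[ℂ] V₂ →ₗ[ℂ] 𝔨₂
  ψ₁_symm : ∀ u v, ψ₁ u v = ψ₁ v u
  ψ₂_skew : ∀ u v, ψ₂ u v = -ψ₂ v u
  π₁_skew : ∀ u v, π₁ u v = -π₁ v u
  π₂_symm : ∀ u v, π₂ u v = π₂ v u
  ψ₁_inv : ∀ x u v, ψ₁ (ρ₁ x u) v + ψ₁ u (ρ₁ x v) = 0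
  ψ₂_inv : ∀ x u v, ψ₂ (ρ₂ x u) v + ψ₂ u (ρ₂ x v) = 0
  π₁_inv : ∀ x u v, ⁅x, π₁ u v⁆ = π₁ (ρ₁ x u) v + π₁ u (ρ₁ x v)
  π₂_inv : ∀ x u v, ⁅x, π₂ u v⁆ = π₂ (ρ₂ x u) v + π₂ u (ρ₂ x v)
  jacobi : ∀ u₁ v₁ w₁ u₂ v₂ w₂,
    (ψ₂ u₂ v₂ • ρ₁ (π₁ u₁ v₁) w₁ ⊗ₜ[ℂ] w₂ + ψ₁ u₁ v₁ • w₁ ⊗ₜ[ℂ] ρ₂ (π₂ u₂ v₂) w₂) +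
    (ψ₂ v₂ w₂ • ρ₁ (π₁ v₁ w₁) u₁ ⊗ₜ[ℂ] u₂ + ψ₁ v₁ w₁ • u₁ ⊗ₜ[ℂ] ρ₂ (π₂ v₂ w₂) u₂) +
    (ψ₂ w₂ u₂ • ρ₁ (π₁ w₁ u₁) v₁ ⊗ₜ[ℂ] v₂ + ψ₁ w₁ u₁ • v₁ ⊗ₜ[ℂ] ρ₂ (π₂ w₂ u₂) v₂) = 0

namespace LieSuperData

section

variable {𝔨₁ 𝔨₂ V₁ V₂ : Type*} [LieRing 𝔨₁] [LieAlgebra ℂ 𝔨₁]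
    [LieRing 𝔨₂] [LieAlgebra ℂ 𝔨₂] [AddCommGroup V₁] [Module ℂ V₁]
    [AddCommGroup V₂] [Module ℂ V₂] (D : LieSuperData 𝔨₁ 𝔨₂ V₁ V₂)

/-- The action `(x, y) ↦ ρ₁ x ⊗ 1 + 1 ⊗ ρ₂ y` of `𝔨₁ × 𝔨₂` on `V₁ ⊗ V₂`. -/
noncomputable def tensorAction : 𝔨₁ × 𝔨₂ →ₗ⁅ℂ⁆ Module.End ℂ (V₁ ⊗[ℂ] V₂) where
  toFun z := TensorProduct.map (D.ρ₁ z.1) LinearMap.id + TensorProduct.map LinearMap.id (D.ρ₂ z.2)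
  map_add' z w := by
    apply TensorProduct.ext'
    intro u v
    simp [TensorProduct.add_tmul, TensorProduct.tmul_add]
    abel
  map_smul' c z := by
    apply TensorProduct.ext'
    intro u v
    simp [TensorProduct.smul_tmul']
  map_lie' := by
    intro z w
    apply TensorProduct.ext'
    intro u v
    simp [LieRing.of_associative_ring_bracket, TensorProduct.sub_tmul, TensorProduct.tmul_sub]
    abel

@[simp]
theorem tensorAction_tmul (z : 𝔨₁ × 𝔨₂) (u : V₁) (v : V₂) :
    D.tensorAction z (u ⊗ₜ v) = D.ρ₁ z.1 u ⊗ₜ v + u ⊗ₜ D.ρ₂ z.2 v := rfl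

/-- The product `[u₁ ⊗ u₂, v₁ ⊗ v₂] = ψ₂(u₂, v₂) π₁(u₁, v₁) + ψ₁(u₁, v₁) π₂(u₂, v₂)`. -/
noncomputable def oddBracket : V₁ ⊗[ℂ] V₂ →ₗ[ℂ] V₁ ⊗[ℂ] V₂ →ₗ[ℂ] 𝔨₁ × 𝔨₂ :=
  (TensorProduct.map₂ D.π₁ D.ψ₂).compr₂
      (LinearMap.inl ℂ 𝔨₁ 𝔨₂ ∘ₗ (TensorProduct.rid ℂ 𝔨₁).toLinearMap) +
    (TensorProduct.map₂ D.ψ₁ D.π₂).compr₂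
      (LinearMap.inr ℂ 𝔨₁ 𝔨₂ ∘ₗ (TensorProduct.lid ℂ 𝔨₂).toLinearMap)

@[simp]
theorem oddBracket_tmul (u₁ v₁ : V₁) (u₂ v₂ : V₂) :
    D.oddBracket (u₁ ⊗ₜ u₂) (v₁ ⊗ₜ v₂) = (D.ψ₂ u₂ v₂ • D.π₁ u₁ v₁, D.ψ₁ u₁ v₁ • D.π₂ u₂ v₂) := by
  simp [oddBracket]

/-- The Lie superalgebra `(𝔨₁ × 𝔨₂) ⊕ (V₁ ⊗ V₂)`. -/
noncomputable def toLieSuperalgebra : LieSuperalgebra (𝔨₁ × 𝔨₂) (V₁ ⊗[ℂ] V₂) where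
  act := D.tensorAction
  bracket := D.oddBracket
  bracket_symm a b := by
    induction a with
    | zero => simp
    | add a a' h h' => simp [h, h']
    | tmul u₁ u₂ =>
      induction b with
      | zero => simp
      | add b b' h h' => simp [h, h']
      | tmul v₁ v₂ =>
        rw [oddBracket_tmul, oddBracket_tmul, D.ψ₂_skew u₂ v₂, D.π₁_skew u₁ v₁, D.ψ₁_symm u₁ v₁,
          D.π₂_symm u₂ v₂, neg_smul_neg]
  lie_bracket x a b := by
    induction a with
    | zero => simp
    | add a a' h h' => simp only [map_add, LinearMap.add_apply, lie_add, h, h']; abel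
    | tmul u₁ u₂ =>
      induction b with
      | zero => simp
      | add b b' h h' => simp only [map_add, LinearMap.add_apply, lie_add, h, h']; abel
      | tmul v₁ v₂ =>
        have h1 := D.ψ₁_inv x.1 u₁ v₁
        have h2 := D.ψ₂_inv x.2 u₂ v₂
        rw [add_eq_zero_iff_eq_neg] at h1 h2
        simp only [oddBracket_tmul, tensorAction_tmul, map_add, LinearMap.add_apply,
          LieAlgebra.Prod.bracket_apply, lie_smul, D.π₁_inv, D.π₂_inv, h1, h2]
        ext
        · simp; abel
        · simp; abel
  jacobi a b c := by
    induction a with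
    | zero => simp
    | add a a' h h' =>
      have := congrArg₂ (· + ·) h h'
      simp only [map_add, LinearMap.add_apply] at this ⊢
      rw [← add_zero (0 : V₁ ⊗[ℂ] V₂), ← this]; abel
    | tmul u₁ u₂ =>
      induction b with
      | zero => simp
      | add b b' h h' =>
        have := congrArg₂ (· + ·) h h'
        simp only [map_add, LinearMap.add_apply] at this ⊢
        rw [← add_zero (0 : V₁ ⊗[ℂ] V₂), ← this]; abel
      | tmul v₁ v₂ =>
        induction c with
        | zero => simp
        | add c c' h h' =>
          have := congrArg₂ (· + ·) h h'
          simp only [map_add, LinearMap.add_apply] at this ⊢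
          rw [← add_zero (0 : V₁ ⊗[ℂ] V₂), ← this]; abel
        | tmul w₁ w₂ =>
          have := D.jacobi u₁ v₁ w₁ u₂ v₂ w₂
          simpa only [oddBracket_tmul, tensorAction_tmul, map_smul, LinearMap.smul_apply,
            TensorProduct.smul_tmul', TensorProduct.tmul_smul] using this

end

end LieSuperData

/-! ### The orthosymplectic Lie superalgebras -/

section Forms

variable {V : Type*} [AddCommGroup V] [Module ℂ V] (ψ : LinearMap.BilinForm ℂ V)

/-- The map `(u, v) ↦ (w ↦ ψ(v, w) u - ψ(w, u) v)`. -/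
def formMap : V →ₗ[ℂ] V →ₗ[ℂ] Module.End ℂ V :=
  LinearMap.mk₂ ℂ
    (fun u v => (ψ v).smulRight u - (ψ.flip u).smulRight v)
    (fun u u' v => by ext w; simp [add_smul]; abel)
    (fun c u v => by ext w; simp [smul_sub, smul_smul, mul_comm])
    (fun u v v' => by ext w; simp [add_smul]; abel)
    (fun c u v => by ext w; simp [smul_sub, smul_smul, mul_comm])

@[simp]
theorem formMap_apply (u v w : V) : formMap ψ u v w = ψ v w • u - ψ w u • v := rfl

theorem mem_skewAdjointLieSubalgebra_iff (x : Module.End ℂ V) :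
    x ∈ skewAdjointLieSubalgebra ψ ↔ ∀ u v, ψ (x u) v + ψ u (x v) = 0 := by
  rw [← LieSubalgebra.mem_toSubmodule]
  refine ⟨fun h u v => ?_, fun h u v => ?_⟩
  · have := h u v
    simp only [LinearMap.neg_apply, map_neg, Pi.neg_apply] at this
    rw [this]; ring
  · have := h u v
    simp only [LinearMap.neg_apply, map_neg, Pi.neg_apply]
    linear_combination this

theorem skewAdjoint_apply (x : skewAdjointLieSubalgebra ψ) (u v : V) :
    ψ (x.1 u) v + ψ u (x.1 v) = 0 :=
  (mem_skewAdjointLieSubalgebra_iff ψ x.1).1 x.2 u v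

variable {ψ}

theorem formMap_mem {ε : ℂ} (hε : ε * ε = 1) (h : ∀ u v, ψ u v = ε * ψ v u) (u v : V) :
    formMap ψ u v ∈ skewAdjointLieSubalgebra ψ := by
  rw [mem_skewAdjointLieSubalgebra_iff]
  intro w z
  simp only [formMap_apply, map_sub, map_smul, LinearMap.sub_apply, LinearMap.smul_apply,
    smul_eq_mul]
  rw [h w v, h z u]
  linear_combination -ψ v w * ψ u z * hε

/-- `formMap ψ`, as a map into the Lie algebra of all endomorphisms that preserve `ψ`. -/
def skewMap {ε : ℂ} (hε : ε * ε = 1) (h : ∀ u v, ψ u v = ε * ψ v u) :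
    V →ₗ[ℂ] V →ₗ[ℂ] skewAdjointLieSubalgebra ψ :=
  LinearMap.mk₂ ℂ (fun u v => ⟨formMap ψ u v, formMap_mem hε h u v⟩)
    (fun u u' v => by ext1; simp) (fun c u v => by ext1; simp)
    (fun u v v' => by ext1; simp) (fun c u v => by ext1; simp)

@[simp]
theorem coe_skewMap {ε : ℂ} (hε : ε * ε = 1) (h : ∀ u v, ψ u v = ε * ψ v u) (u v : V) :
    (skewMap hε h u v : Module.End ℂ V) = formMap ψ u v := rfl

theorem lie_skewMap {ε : ℂ} (hε : ε * ε = 1) (h : ∀ u v, ψ u v = ε * ψ v u)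
    (x : skewAdjointLieSubalgebra ψ) (u v : V) :
    ⁅x, skewMap hε h u v⁆ = skewMap hε h (x.1 u) v + skewMap hε h u (x.1 v) := by
  ext w
  have h1 := skewAdjoint_apply ψ x v w
  have h2 := skewAdjoint_apply ψ x w u
  rw [add_eq_zero_iff_eq_neg] at h1
  rw [add_eq_zero_iff_eq_neg'] at h2
  simp only [LieSubalgebra.coe_bracket, LieRing.of_associative_ring_bracket, coe_skewMap,
    LinearMap.sub_apply, Module.End.mul_apply, formMap_apply, map_sub, map_smul,
    AddMemClass.coe_add, LinearMap.add_apply, h1, h2]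
  simp only [neg_smul]
  abel

theorem skewMap_comm {ε : ℂ} (hε : ε * ε = 1) (h : ∀ u v, ψ u v = ε * ψ v u) (u v : V) :
    skewMap hε h u v = -ε • skewMap hε h v u := by
  ext w
  simp only [coe_skewMap, formMap_apply, SetLike.val_smul, LinearMap.smul_apply]
  have e : ψ w v = ε * ψ v w := h w v
  have e2 : ε * ψ w v = ψ v w := by rw [e, ← mul_assoc, hε, one_mul]
  have e3 : ψ w u = ε * ψ u w := h w u
  rw [smul_sub, smul_smul, smul_smul, neg_mul, neg_mul, e2, ← e3]
  module

end Forms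

/-- The Lie superalgebra `osp(V₁, V₂)`, where `V₁` carries a symmetric form `ψ₁` and `V₂` a
skew-symmetric form `ψ₂`. The even part is `so(V₁) × sp(V₂)`, the odd part is `V₁ ⊗ V₂`, and
`πᵢ(u, v) w = ψᵢ(v, w) u - ψᵢ(w, u) v`. -/
def osp {V₁ V₂ : Type*} [AddCommGroup V₁] [Module ℂ V₁] [AddCommGroup V₂] [Module ℂ V₂]
    (ψ₁ : LinearMap.BilinForm ℂ V₁) (ψ₂ : LinearMap.BilinForm ℂ V₂)
    (h₁ : ∀ u v, ψ₁ u v = ψ₁ v u) (h₂ : ∀ u v, ψ₂ u v = -ψ₂ v u) :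
    LieSuperData (skewAdjointLieSubalgebra ψ₁) (skewAdjointLieSubalgebra ψ₂) V₁ V₂ where
  ρ₁ := (skewAdjointLieSubalgebra ψ₁).incl
  ρ₂ := (skewAdjointLieSubalgebra ψ₂).incl
  ψ₁ := ψ₁
  ψ₂ := ψ₂
  π₁ := skewMap (ε := 1) (by norm_num) (by simpa using h₁)
  π₂ := skewMap (ε := -1) (by norm_num) (by simpa using h₂)
  ψ₁_symm := h₁
  ψ₂_skew := h₂
  π₁_skew u v := by simpa using skewMap_comm (ψ := ψ₁) (ε := 1) (by norm_num) (by simpa using h₁) u v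
  π₂_symm u v := by simpa using skewMap_comm (ψ := ψ₂) (ε := -1) (by norm_num) (by simpa using h₂) u v
  ψ₁_inv := skewAdjoint_apply ψ₁
  ψ₂_inv := skewAdjoint_apply ψ₂
  π₁_inv := lie_skewMap _ _
  π₂_inv := lie_skewMap _ _
  jacobi u₁ v₁ w₁ u₂ v₂ w₂ := by
    simp only [LieSubalgebra.coe_incl, coe_skewMap, formMap_apply, TensorProduct.sub_tmul,
      TensorProduct.tmul_sub, smul_sub, ← TensorProduct.smul_tmul', TensorProduct.tmul_smul,
      smul_smul]
    module

/-- The standard symplectic form on `ℂ²`. -/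
def symplecticForm : LinearMap.BilinForm ℂ (Fin 2 → ℂ) :=
  LinearMap.mk₂ ℂ (fun u v => u 0 * v 1 - u 1 * v 0)
    (fun u u' v => by simp; ring) (fun c u v => by simp; ring)
    (fun u v v' => by simp; ring) (fun c u v => by simp; ring)

@[simp]
theorem symplecticForm_apply (u v : Fin 2 → ℂ) :
    symplecticForm u v = u 0 * v 1 - u 1 * v 0 := rfl

theorem symplecticForm_skew (u v : Fin 2 → ℂ) : symplecticForm u v = -symplecticForm v u := by
  simp; ring

/-- The Lie algebra `sp(2)` of the symplectic form on `ℂ²` is `sl(2)`. -/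
theorem mem_skewAdjoint_symplecticForm (x : Module.End ℂ (Fin 2 → ℂ)) :
    x ∈ skewAdjointLieSubalgebra symplecticForm ↔ LinearMap.trace ℂ (Fin 2 → ℂ) x = 0 := by
  have hx : ∀ u, x u = u 0 • x (Pi.single 0 1) + u 1 • x (Pi.single 1 1) := by
    intro u
    rw [← map_smul, ← map_smul, ← map_add]
    congr 1
    ext i; fin_cases i <;> simp
  have ht : LinearMap.trace ℂ (Fin 2 → ℂ) x =
      x (Pi.single 0 1) 0 + x (Pi.single 1 1) 1 := by
    rw [LinearMap.trace_eq_matrix_trace ℂ (Pi.basisFun ℂ (Fin 2)), Matrix.trace_fin_two]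
    simp [LinearMap.toMatrix_apply]
  rw [mem_skewAdjointLieSubalgebra_iff, ht]
  refine ⟨fun h => ?_, fun h u v => ?_⟩
  · simpa using h (Pi.single 0 1) (Pi.single 1 1)
  · rw [hx u, hx v]
    simp only [symplecticForm_apply, Pi.add_apply, Pi.smul_apply, smul_eq_mul]
    linear_combination (u 0 * v 1 - u 1 * v 0) * h

/-- On `ℂ²`, `ψ(u, v) w + ψ(v, w) u + ψ(w, u) v = 0`. -/
theorem symplecticForm_cyclic (u v w : Fin 2 → ℂ) :
    symplecticForm u v • w + symplecticForm v w • u + symplecticForm w u • v = 0 := by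
  ext i; fin_cases i <;> simp <;> ring

/-- Jacobi identity when `V₂ = ℂ²`, `𝔨₂ = sl(2)`. -/
theorem jacobi_of_rankTwo {V : Type*} [AddCommGroup V] [Module ℂ V] (ψ : LinearMap.BilinForm ℂ V)
    (P : V → V → V → V) (hψ : ∀ u v, ψ u v = ψ v u) (hP : ∀ u v w, P u v w = -P v u w)
    (h : ∀ u v w, P u v w + P u w v = (2 * ψ v w) • u - ψ u v • w - ψ u w • v)
    (u₁ v₁ w₁ : V) (u₂ v₂ w₂ : Fin 2 → ℂ) :
    (symplecticForm u₂ v₂ • P u₁ v₁ w₁ ⊗ₜ[ℂ] w₂ +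
      ψ u₁ v₁ • w₁ ⊗ₜ[ℂ] formMap symplecticForm u₂ v₂ w₂) +
    (symplecticForm v₂ w₂ • P v₁ w₁ u₁ ⊗ₜ[ℂ] u₂ +
      ψ v₁ w₁ • u₁ ⊗ₜ[ℂ] formMap symplecticForm v₂ w₂ u₂) +
    (symplecticForm w₂ u₂ • P w₁ u₁ v₁ ⊗ₜ[ℂ] v₂ +
      ψ w₁ u₁ • v₁ ⊗ₜ[ℂ] formMap symplecticForm w₂ u₂ v₂) = 0 := by
  have hc := symplecticForm_cyclic u₂ v₂ w₂
  have e1 := h u₁ v₁ w₁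
  have e2 := h v₁ w₁ u₁
  rw [hP u₁ w₁ v₁] at e1
  rw [hP v₁ u₁ w₁] at e2
  have p2 : P w₁ u₁ v₁ = P u₁ v₁ w₁ - ((2 * ψ v₁ w₁) • u₁ - ψ u₁ v₁ • w₁ - ψ u₁ w₁ • v₁) := by
    rw [← e1]; abel
  have p1 : P v₁ w₁ u₁ = P u₁ v₁ w₁ + ((2 * ψ w₁ u₁) • v₁ - ψ v₁ w₁ • u₁ - ψ v₁ u₁ • w₁) := by
    rw [← e2]; abel
  have a2 : symplecticForm w₂ u₂ • v₂ = -(symplecticForm u₂ v₂ • w₂) - symplecticForm v₂ w₂ • u₂ := by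
    rw [← sub_eq_zero, ← hc]; abel
  simp only [formMap_apply, p1, p2, hψ v₁ u₁, hψ w₁ u₁, ← TensorProduct.tmul_smul, a2]
  simp only [TensorProduct.tmul_sub, TensorProduct.tmul_add, TensorProduct.sub_tmul, a2,
    TensorProduct.add_tmul, TensorProduct.tmul_smul, ← TensorProduct.smul_tmul', TensorProduct.tmul_neg]
  module

/-! ### The Lie superalgebra `G(3)` -/

/-- The dot product on `ℂ⁷`. -/
def dot7 : LinearMap.BilinForm ℂ (Fin 7 → ℂ) :=
  LinearMap.mk₂ ℂ (fun u v => ∑ i, u i * v i)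
    (fun u u' v => by simp [add_mul, Finset.sum_add_distrib])
    (fun c u v => by simp [Finset.mul_sum, mul_assoc])
    (fun u v v' => by simp [mul_add, Finset.sum_add_distrib])
    (fun c u v => by simp [Finset.mul_sum, mul_left_comm])

theorem dot7_apply (u v : Fin 7 → ℂ) : dot7 u v = ∑ i, u i * v i := rfl

/-- The cross product on `ℂ⁷` (the imaginary octonions): the bilinear skew-symmetric product with
`e i × e (i + 1) = e (i + 3)`, `e (i + 1) × e (i + 3) = e i`, `e (i + 3) × e i = e (i + 1)`, the
indices being taken modulo `7`. -/
def cross7 : (Fin 7 → ℂ) →ₗ[ℂ] (Fin 7 → ℂ) →ₗ[ℂ] (Fin 7 → ℂ) :=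
  LinearMap.mk₂ ℂ
    (fun u v k => (u (k + 1) * v (k + 3) - u (k + 3) * v (k + 1)) +
      (u (k + 2) * v (k + 6) - u (k + 6) * v (k + 2)) +
      (u (k + 4) * v (k + 5) - u (k + 5) * v (k + 4)))
    (fun u u' v => by ext k; simp; ring) (fun c u v => by ext k; simp; ring)
    (fun u v v' => by ext k; simp; ring) (fun c u v => by ext k; simp; ring)

theorem cross7_apply (u v : Fin 7 → ℂ) (k : Fin 7) :
    cross7 u v k = (u (k + 1) * v (k + 3) - u (k + 3) * v (k + 1)) +
      (u (k + 2) * v (k + 6) - u (k + 6) * v (k + 2)) +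
      (u (k + 4) * v (k + 5) - u (k + 5) * v (k + 4)) := rfl

theorem dot7_symm (u v : Fin 7 → ℂ) : dot7 u v = dot7 v u := by
  simp only [dot7_apply, mul_comm]

theorem cross7_skew (u v : Fin 7 → ℂ) : cross7 u v = -cross7 v u := by
  ext k; simp only [cross7_apply, Pi.neg_apply]; ring

theorem dot7_cross7 (u v w : Fin 7 → ℂ) : dot7 (cross7 u v) w = dot7 u (cross7 v w) := by
  simp only [dot7_apply, cross7_apply, Fin.sum_univ_seven]
  simp only [Fin.isValue, Fin.reduceAdd, zero_add]
  ring

theorem cross7_cross7 (u v w : Fin 7 → ℂ) : cross7 u (cross7 v w) + cross7 v (cross7 u w) =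
    dot7 u w • v + dot7 v w • u - (2 * dot7 u v) • w := by
  ext k
  fin_cases k <;>
  · simp only [dot7_apply, cross7_apply, Fin.sum_univ_seven, Pi.add_apply, Pi.sub_apply,
      Pi.smul_apply, smul_eq_mul, Fin.isValue, Fin.reduceAdd, zero_add, Fin.reduceFinMk,
      Fin.zero_eta, Fin.mk_one]
    ring

/-- The exceptional Lie algebra `𝔤₂`, realized as the derivations of the cross product on `ℂ⁷`
(equivalently, of the complex octonions). -/
def g2 : LieSubalgebra ℂ (Module.End ℂ (Fin 7 → ℂ)) where
  carrier := {x | ∀ u v, x (cross7 u v) = cross7 (x u) v + cross7 u (x v)}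
  add_mem' {x y} hx hy u v := by
    simp only [LinearMap.add_apply, hx u v, hy u v, map_add]; abel
  zero_mem' u v := by simp
  smul_mem' c x hx u v := by simp [hx u v]
  lie_mem' {x y} hx hy u v := by
    simp only [LieRing.of_associative_ring_bracket, LinearMap.sub_apply, Module.End.mul_apply,
      hx _ _, hy _ _, map_add, map_sub]
    abel

theorem g2_apply (x : g2) (u v : Fin 7 → ℂ) :
    x.1 (cross7 u v) = cross7 (x.1 u) v + cross7 u (x.1 v) := x.2 u v

/-- `𝔤₂` preserves the dot product. -/
theorem g2_dot7 (x : g2) (u v : Fin 7 → ℂ) : dot7 (x.1 u) v + dot7 u (x.1 v) = 0 := by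
  set s : LinearMap.BilinForm ℂ (Fin 7 → ℂ) := dot7 ∘ₗ x.1 + dot7.compl₂ x.1 with hs
  have key : ∀ u v, s u v • u = s u u • v := by
    intro u v
    have h1 := congrArg x.1 (cross7_cross7 u u v)
    have h2 := cross7_cross7 u u (x.1 v)
    have h3 := cross7_cross7 (x.1 u) u v
    simp only [map_add, map_sub, map_smul, g2_apply] at h1
    simp only [hs, LinearMap.add_apply, LinearMap.comp_apply, LinearMap.compl₂_apply]
    have h4 := dot7_symm (x.1 u) u
    rw [h4]
    rw [h4] at h3
    linear_combination (norm := module) (1 / 2 : ℂ) • h1 - (1 / 2 : ℂ) • h2 - h3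
  have : s = 0 := by
    refine LinearMap.BilinForm.ext_basis (Pi.basisFun ℂ (Fin 7)) fun i j => ?_
    have aux : ∀ i j : Fin 7, i ≠ j →
        s (Pi.single i 1) (Pi.single j 1) = 0 ∧ s (Pi.single i 1) (Pi.single i 1) = 0 := by
      intro i j hij
      have := key (Pi.single i 1) (Pi.single j 1)
      have a := congrFun this i
      have b := congrFun this j
      simp [hij, hij.symm] at a b
      exact ⟨a, b.symm⟩
    simp only [Pi.basisFun_apply, LinearMap.zero_apply]
    by_cases hij : i = j
    · subst hij
      exact (aux i (i + 1) (by decide +revert)).2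
    · exact (aux i j hij).1
  have := congrArg (fun t : LinearMap.BilinForm ℂ (Fin 7 → ℂ) => t u v) this
  simpa [hs] using this

/-- The endomorphism `w ↦ (1/2) (u × v) × w + (3/2) (⟨v, w⟩ u - ⟨w, u⟩ v)` of `ℂ⁷`. -/
noncomputable def g2End : (Fin 7 → ℂ) →ₗ[ℂ] (Fin 7 → ℂ) →ₗ[ℂ] Module.End ℂ (Fin 7 → ℂ) :=
  (1 / 2 : ℂ) • cross7.compr₂ cross7 + (3 / 2 : ℂ) • formMap dot7

theorem g2End_apply (u v w : Fin 7 → ℂ) : g2End u v w =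
    (1 / 2 : ℂ) • cross7 (cross7 u v) w + (3 / 2 : ℂ) • (dot7 v w • u - dot7 w u • v) := rfl

theorem g2End_mem (u v : Fin 7 → ℂ) : g2End u v ∈ g2 := by
  intro a b
  simp only [g2End_apply]
  ext k
  fin_cases k <;>
  · simp only [dot7_apply, cross7_apply, Fin.sum_univ_seven, Pi.add_apply, Pi.sub_apply,
      Pi.smul_apply, smul_eq_mul, Fin.isValue, Fin.reduceAdd, zero_add, Fin.reduceFinMk,
      Fin.zero_eta, Fin.mk_one]
    ring

/-- The map `π₁ : ℂ⁷ × ℂ⁷ → 𝔤₂`. -/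
noncomputable def g2Map : (Fin 7 → ℂ) →ₗ[ℂ] (Fin 7 → ℂ) →ₗ[ℂ] g2 :=
  LinearMap.mk₂ ℂ (fun u v => ⟨g2End u v, g2End_mem u v⟩)
    (fun u u' v => by ext1; simp) (fun c u v => by ext1; simp)
    (fun u v v' => by ext1; simp) (fun c u v => by ext1; simp)

theorem coe_g2Map (u v : Fin 7 → ℂ) : (g2Map u v : Module.End ℂ (Fin 7 → ℂ)) = g2End u v := rfl

theorem g2End_skew (u v w : Fin 7 → ℂ) : g2End u v w = -g2End v u w := by
  simp only [g2End_apply]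
  rw [cross7_skew u v, dot7_symm v w, dot7_symm w u, map_neg, LinearMap.neg_apply]
  module

/-- The Lie superalgebra `G(3)`, with even part `𝔤₂ × sl(2)` and odd part `ℂ⁷ ⊗ ℂ²`. -/
noncomputable def G3 : LieSuperData g2 (skewAdjointLieSubalgebra symplecticForm)
    (Fin 7 → ℂ) (Fin 2 → ℂ) where
  ρ₁ := g2.incl
  ρ₂ := (skewAdjointLieSubalgebra symplecticForm).incl
  ψ₁ := dot7
  ψ₂ := symplecticForm
  π₁ := g2Map
  π₂ := skewMap (ε := -1) (by norm_num) (by simpa using symplecticForm_skew)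
  ψ₁_symm := dot7_symm
  ψ₂_skew := symplecticForm_skew
  π₁_skew u v := by
    ext1
    exact LinearMap.ext fun w => g2End_skew u v w
  π₂_symm u v := by
    simpa using skewMap_comm (ψ := symplecticForm) (ε := -1) (by norm_num)
      (by simpa using symplecticForm_skew) u v
  ψ₁_inv := g2_dot7
  ψ₂_inv := skewAdjoint_apply symplecticForm
  π₁_inv x u v := by
    ext1
    refine LinearMap.ext fun w => ?_
    have h1 := g2_dot7 x v w
    have h2 := g2_dot7 x w u
    rw [add_eq_zero_iff_eq_neg] at h1
    rw [add_eq_zero_iff_eq_neg'] at h2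
    simp only [LieSubalgebra.coe_bracket, LieRing.of_associative_ring_bracket, coe_g2Map,
      LieSubalgebra.coe_incl, LinearMap.sub_apply, Module.End.mul_apply, g2End_apply, map_sub,
      map_add, map_smul, g2_apply, AddMemClass.coe_add, LinearMap.add_apply, h1, h2]
    module
  π₂_inv := lie_skewMap _ _
  jacobi := by
    refine jacobi_of_rankTwo dot7 (fun u v w => g2End u v w) dot7_symm g2End_skew ?_
    intro u v w
    have h := cross7_cross7 v w u
    simp only [g2End_apply]
    rw [cross7_skew (cross7 u v) w, cross7_skew (cross7 u w) v, cross7_skew u v, cross7_skew u w,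
      map_neg, map_neg, dot7_symm w u, dot7_symm v u, dot7_symm w v]
    rw [dot7_symm v u, dot7_symm w u] at h
    linear_combination (norm := module) (1 / 2 : ℂ) • h

/-! ### The Lie superalgebra `F(4)` -/

/-- The dot product on `ℂ ⊕ ℂ⁷ = ℂ⁸` (the octonions). -/
def dot8 : LinearMap.BilinForm ℂ (ℂ × (Fin 7 → ℂ)) :=
  LinearMap.mk₂ ℂ (fun a b => a.1 * b.1 + dot7 a.2 b.2)
    (fun u u' v => by simp; ring) (fun c u v => by simp; ring)
    (fun u v v' => by simp; ring) (fun c u v => by simp; ring)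

theorem dot8_apply (a b : ℂ × (Fin 7 → ℂ)) : dot8 a b = a.1 * b.1 + dot7 a.2 b.2 := rfl

/-- Clifford multiplication of `ℂ⁷` on `ℂ ⊕ ℂ⁷`: the left multiplication
`p ↦ ((a, w) ↦ (-⟨p, w⟩, a p + p × w))` by imaginary octonions. -/
def cliff : (Fin 7 → ℂ) →ₗ[ℂ] Module.End ℂ (ℂ × (Fin 7 → ℂ)) :=
  LinearMap.mk₂ ℂ (fun p a => (-dot7 p a.2, a.1 • p + cross7 p a.2))
    (fun u u' v => by ext1 <;> simp; ring; abel)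
    (fun c u v => by
      ext1
      · simp
      · simp only [map_smul, LinearMap.smul_apply, Prod.smul_snd]; module)
    (fun u v v' => by ext1 <;> simp [add_smul]; ring; abel)
    (fun c u v => by
      ext1
      · simp
      · simp only [map_smul, Prod.smul_fst, Prod.smul_snd, smul_eq_mul]; module)

theorem cliff_apply (p : Fin 7 → ℂ) (a : ℂ × (Fin 7 → ℂ)) :
    cliff p a = (-dot7 p a.2, a.1 • p + cross7 p a.2) := rfl

theorem cross7_self (u : Fin 7 → ℂ) : cross7 u u = 0 := by
  ext k; simp only [cross7_apply, Pi.zero_apply]; ring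

/-- The Clifford relations. -/
theorem cliff_cliff (p q : Fin 7 → ℂ) (a : ℂ × (Fin 7 → ℂ)) :
    cliff p (cliff q a) + cliff q (cliff p a) = -(2 * dot7 p q) • a := by
  have h := cross7_cross7 p q a.2
  have h1 : dot7 p (cross7 q a.2) = -dot7 q (cross7 p a.2) := by
    rw [← dot7_cross7, ← dot7_cross7, cross7_skew p q, map_neg, LinearMap.neg_apply]
  simp only [cliff_apply, map_add, map_smul, h1, dot7_symm q p, cross7_skew q p, smul_eq_mul]
  ext1
  · simp; ring
  · simp only [Prod.snd_add, Prod.smul_snd, smul_neg]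
    linear_combination (norm := module) h

theorem dot8_cliff (p : Fin 7 → ℂ) (a b : ℂ × (Fin 7 → ℂ)) :
    dot8 (cliff p a) b + dot8 a (cliff p b) = 0 := by
  simp only [dot8_apply, cliff_apply, map_add, map_smul, LinearMap.add_apply, LinearMap.smul_apply,
    smul_eq_mul]
  rw [dot7_symm a.2 p, cross7_skew p a.2, map_neg, LinearMap.neg_apply, dot7_cross7]
  ring

/-- The spin representation of `so(7)` on `ℂ⁸`: `x ↦ -(1/4) ∑ j, γ(x e_j) γ(e_j)`, where `γ` is the
Clifford multiplication. -/
noncomputable def spinEnd : Module.End ℂ (Fin 7 → ℂ) →ₗ[ℂ] Module.End ℂ (ℂ × (Fin 7 → ℂ)) where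
  toFun x := -(1 / 4 : ℂ) • ∑ j, cliff (x (Pi.single j 1)) * cliff (Pi.single j 1)
  map_add' x y := by
    simp only [LinearMap.add_apply, map_add, add_mul, Finset.sum_add_distrib, smul_add]
  map_smul' c x := by
    simp only [LinearMap.smul_apply, map_smul, smul_mul_assoc, ← Finset.smul_sum, RingHom.id_apply,
      smul_comm c]

theorem spinEnd_apply (x : Module.End ℂ (Fin 7 → ℂ)) :
    spinEnd x = -(1 / 4 : ℂ) • ∑ j, cliff (x (Pi.single j 1)) * cliff (Pi.single j 1) := rfl

section

attribute [local irreducible] cliff spinEnd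

theorem cliff_mul (p q : Fin 7 → ℂ) :
    cliff p * cliff q + cliff q * cliff p = -(2 * dot7 p q) • 1 :=
  LinearMap.ext fun a => cliff_cliff p q a

theorem sum_dot7_smul (p : Fin 7 → ℂ) : ∑ j, dot7 p (Pi.single j 1) • Pi.single j (1 : ℂ) = p := by
  ext k
  simp [dot7_apply, Finset.sum_apply, Pi.single_apply]

/-- `[ρ(x), γ(p)] = γ(x p)`. -/
theorem spinEnd_cliff (x : skewAdjointLieSubalgebra dot7) (p : Fin 7 → ℂ) :
    spinEnd x.1 * cliff p - cliff p * spinEnd x.1 = cliff (x.1 p) := by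
  have e : ∀ j, cliff (x.1 (Pi.single j 1)) * cliff (Pi.single j 1) * cliff p -
      cliff p * (cliff (x.1 (Pi.single j 1)) * cliff (Pi.single j 1)) =
      -(2 : ℂ) • (dot7 p (Pi.single j 1) • cliff (x.1 (Pi.single j 1))
        + dot7 (x.1 p) (Pi.single j 1) • cliff (Pi.single j 1)) := by
    intro j
    have h1 := cliff_mul p (x.1 (Pi.single j 1))
    have h2 := cliff_mul p (Pi.single j 1)
    have h3 := skewAdjoint_apply dot7 x p (Pi.single j 1)
    have h4 : dot7 p (x.1 (Pi.single j 1)) = -dot7 (x.1 p) (Pi.single j 1) := by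
      linear_combination h3
    rw [h4] at h1
    have h1' := congrArg (· * cliff (Pi.single j 1)) h1
    have h2' := congrArg (cliff (x.1 (Pi.single j 1)) * ·) h2
    simp only [add_mul, mul_add, smul_mul_assoc, mul_smul_comm, one_mul, mul_one, mul_assoc]
      at h1' h2' ⊢
    linear_combination (norm := module) h2' - h1'
  have s1 : ∑ j, dot7 p (Pi.single j 1) • cliff (x.1 (Pi.single j 1)) = cliff (x.1 p) := by
    simp only [← map_smul, ← map_sum, sum_dot7_smul]
  have s2 : ∑ j, dot7 (x.1 p) (Pi.single j 1) • cliff (Pi.single j 1) = cliff (x.1 p) := by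
    simp only [← map_smul, ← map_sum, sum_dot7_smul]
  have key := Finset.sum_congr (rfl : Finset.univ = Finset.univ) fun j _ => e j
  rw [Finset.sum_sub_distrib, ← Finset.sum_mul, ← Finset.mul_sum, ← Finset.smul_sum,
    Finset.sum_add_distrib, s1, s2] at key
  rw [spinEnd_apply, smul_mul_assoc, mul_smul_comm]
  linear_combination (norm := module) (-(1 / 4 : ℂ)) • key

/-- Skew-adjoint endomorphisms satisfy `∑ j, e_j ⊗ y e_j = -∑ j, y e_j ⊗ e_j`. -/
theorem sum_skew (y : skewAdjointLieSubalgebra dot7) {W : Type*} [AddCommGroup W] [Module ℂ W]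
    (f : (Fin 7 → ℂ) →ₗ[ℂ] (Fin 7 → ℂ) →ₗ[ℂ] W) :
    ∑ j, f (Pi.single j 1) (y.1 (Pi.single j 1)) =
      -∑ j, f (y.1 (Pi.single j 1)) (Pi.single j 1) := by
  have e1 : ∀ j, f (Pi.single j 1) (y.1 (Pi.single j 1)) =
      ∑ k, dot7 (y.1 (Pi.single j 1)) (Pi.single k 1) • f (Pi.single j 1) (Pi.single k 1) := by
    intro j
    conv_lhs => rw [← sum_dot7_smul (y.1 (Pi.single j 1))]
    simp only [map_sum, map_smul]
  have e2 : ∀ k, f (y.1 (Pi.single k 1)) (Pi.single k 1) =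
      ∑ j, dot7 (y.1 (Pi.single k 1)) (Pi.single j 1) • f (Pi.single j 1) (Pi.single k 1) := by
    intro k
    conv_lhs => rw [← sum_dot7_smul (y.1 (Pi.single k 1))]
    simp only [map_sum, map_smul, LinearMap.sum_apply, LinearMap.smul_apply]
  rw [Finset.sum_congr rfl fun j _ => e1 j, Finset.sum_congr rfl fun k _ => e2 k, Finset.sum_comm,
    ← Finset.sum_neg_distrib]
  refine Finset.sum_congr rfl fun k _ => ?_
  rw [← Finset.sum_neg_distrib]
  refine Finset.sum_congr rfl fun j _ => ?_
  have h := skewAdjoint_apply dot7 y (Pi.single j 1) (Pi.single k 1)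
  rw [dot7_symm (Pi.single j 1), add_eq_zero_iff_eq_neg] at h
  rw [h, neg_smul]

/-- The product `(p, q) ↦ γ(p) γ(q)`. -/
def cliffMul : (Fin 7 → ℂ) →ₗ[ℂ] (Fin 7 → ℂ) →ₗ[ℂ] Module.End ℂ (ℂ × (Fin 7 → ℂ)) :=
  LinearMap.mk₂ ℂ (fun p q => cliff p * cliff q)
    (fun p p' q => by rw [map_add, add_mul]) (fun c p q => by rw [map_smul, smul_mul_assoc])
    (fun p q q' => by rw [map_add, mul_add]) (fun c p q => by rw [map_smul, mul_smul_comm])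

theorem cliffMul_apply (p q : Fin 7 → ℂ) : cliffMul p q = cliff p * cliff q := rfl

theorem spinEnd_lie (x y : skewAdjointLieSubalgebra dot7) :
    spinEnd (x.1 * y.1 - y.1 * x.1) = spinEnd x.1 * spinEnd y.1 - spinEnd y.1 * spinEnd x.1 := by
  have e : ∀ j, spinEnd x.1 * (cliff (y.1 (Pi.single j 1)) * cliff (Pi.single j 1)) -
      cliff (y.1 (Pi.single j 1)) * cliff (Pi.single j 1) * spinEnd x.1 =
      cliff (x.1 (y.1 (Pi.single j 1))) * cliff (Pi.single j 1) +
      cliff (y.1 (Pi.single j 1)) * cliff (x.1 (Pi.single j 1)) := by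
    intro j
    rw [← spinEnd_cliff x (y.1 (Pi.single j 1)), ← spinEnd_cliff x (Pi.single j 1)]
    generalize spinEnd x.1 = A
    generalize cliff (y.1 (Pi.single j 1)) = B
    generalize cliff (Pi.single j 1) = C
    simp only [mul_sub, sub_mul, mul_assoc]
    abel
  have s := sum_skew x (cliffMul ∘ₗ y.1)
  simp only [LinearMap.comp_apply, cliffMul_apply] at s
  have key := Finset.sum_congr (rfl : Finset.univ = Finset.univ) fun j _ => e j
  rw [Finset.sum_sub_distrib, ← Finset.sum_mul, ← Finset.mul_sum, Finset.sum_add_distrib, s] at key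
  have t : spinEnd (x.1 * y.1 - y.1 * x.1) = -(1 / 4 : ℂ) •
      (∑ j, cliff (x.1 (y.1 (Pi.single j 1))) * cliff (Pi.single j 1) -
        ∑ j, cliff (y.1 (x.1 (Pi.single j 1))) * cliff (Pi.single j 1)) := by
    rw [spinEnd_apply, ← Finset.sum_sub_distrib]
    simp only [LinearMap.sub_apply, Module.End.mul_apply, map_sub, sub_mul]
  rw [t, spinEnd_apply y.1, mul_smul_comm, smul_mul_assoc]
  linear_combination (norm := module) (1 / 4 : ℂ) • key

/-- The spin representation, as a representation of the Lie algebra `so(7)`. -/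
noncomputable def spin : skewAdjointLieSubalgebra dot7 →ₗ⁅ℂ⁆
    Module.End ℂ (ℂ × (Fin 7 → ℂ)) where
  toFun x := spinEnd x.1
  map_add' x y := map_add spinEnd x.1 y.1
  map_smul' c x := map_smul spinEnd c x.1
  map_lie' := by
    intro x y
    rw [LieSubalgebra.coe_bracket, LieRing.of_associative_ring_bracket,
      LieRing.of_associative_ring_bracket]
    exact spinEnd_lie x y

end

theorem spin_apply (x : skewAdjointLieSubalgebra dot7) : spin x = spinEnd x.1 := rfl

theorem dot8_symm (a b : ℂ × (Fin 7 → ℂ)) : dot8 a b = dot8 b a := by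
  rw [dot8_apply, dot8_apply, dot7_symm, mul_comm]

theorem dot8_spin (x : skewAdjointLieSubalgebra dot7) (a b : ℂ × (Fin 7 → ℂ)) :
    dot8 (spin x a) b + dot8 a (spin x b) = 0 := by
  have h : ∀ p q a b, dot8 (cliff p (cliff q a)) b = dot8 a (cliff q (cliff p b)) := by
    intro p q a b
    linear_combination dot8_cliff p (cliff q a) b - dot8_cliff q a (cliff p b)
  have s := sum_skew x (cliffMul)
  simp only [cliffMul_apply] at s
  have s' := congrArg (fun T : Module.End ℂ (ℂ × (Fin 7 → ℂ)) => dot8 a (T b)) s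
  simp only [LinearMap.sum_apply, LinearMap.neg_apply, map_neg, map_sum, Module.End.mul_apply]
    at s'
  simp only [spin_apply, spinEnd_apply, LinearMap.smul_apply, LinearMap.sum_apply, map_smul,
    map_sum, Module.End.mul_apply, smul_eq_mul, h, s']
  ring

/-- The bilinear map `m : ℂ⁸ × ℂ⁸ → ℂ⁷` with `⟨p, m(a, b)⟩ = ⟨γ(p) a, b⟩`. -/
def spinVec : (ℂ × (Fin 7 → ℂ)) →ₗ[ℂ] (ℂ × (Fin 7 → ℂ)) →ₗ[ℂ] (Fin 7 → ℂ) :=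
  LinearMap.mk₂ ℂ (fun a b => a.1 • b.2 - b.1 • a.2 + cross7 a.2 b.2)
    (fun u u' v => by ext k; simp; ring) (fun c u v => by ext k; simp; ring)
    (fun u v v' => by ext k; simp; ring) (fun c u v => by ext k; simp; ring)

theorem spinVec_apply (a b : ℂ × (Fin 7 → ℂ)) :
    spinVec a b = a.1 • b.2 - b.1 • a.2 + cross7 a.2 b.2 := rfl

theorem dot7_spinVec (p : Fin 7 → ℂ) (a b : ℂ × (Fin 7 → ℂ)) :
    dot7 p (spinVec a b) = dot8 (cliff p a) b := by
  simp only [spinVec_apply, dot8_apply, cliff_apply, map_add, map_sub, map_smul,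
    LinearMap.add_apply, LinearMap.smul_apply, smul_eq_mul, dot7_cross7]
  ring

theorem dot7_ext {u v : Fin 7 → ℂ} (h : ∀ p, dot7 p u = dot7 p v) : u = v := by
  ext k
  simpa [dot7_apply, Pi.single_apply] using h (Pi.single k 1)

theorem spinVec_inv (x : skewAdjointLieSubalgebra dot7) (a b : ℂ × (Fin 7 → ℂ)) :
    spinVec (spin x a) b + spinVec a (spin x b) = x.1 (spinVec a b) := by
  refine dot7_ext fun p => ?_
  have h1 := skewAdjoint_apply dot7 x p (spinVec a b)
  have h2 := dot8_spin x (cliff p a) b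
  have h3 := congrArg (fun T : Module.End ℂ (ℂ × (Fin 7 → ℂ)) => dot8 (T a) b) (spinEnd_cliff x p)
  simp only [LinearMap.sub_apply, Module.End.mul_apply, map_sub, ← spin_apply] at h3
  rw [dot7_spinVec] at h1
  rw [map_add, dot7_spinVec, dot7_spinVec]
  linear_combination h2 - h1 - h3

/-- The endomorphism `π(u, v)` of `ℂ⁷` with
`⟨π(u, v) p, q⟩ = (2/3) (⟨γ(q) γ(p) u, v⟩ + ⟨u, v⟩ ⟨p, q⟩)`. -/
noncomputable def spinPairEnd : (ℂ × (Fin 7 → ℂ)) →ₗ[ℂ] (ℂ × (Fin 7 → ℂ)) →ₗ[ℂ]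
    Module.End ℂ (Fin 7 → ℂ) :=
  LinearMap.mk₂ ℂ
    (fun u v => (2 / 3 : ℂ) • (spinVec.flip v ∘ₗ cliff.flip u + dot8 u v • LinearMap.id))
    (fun u u' v => LinearMap.ext fun p => by simp; module) (fun c u v => LinearMap.ext fun p => by simp; module)
    (fun u v v' => LinearMap.ext fun p => by simp; module) (fun c u v => LinearMap.ext fun p => by simp; module)

theorem spinPairEnd_apply (u v : ℂ × (Fin 7 → ℂ)) (p : Fin 7 → ℂ) :
    spinPairEnd u v p = (2 / 3 : ℂ) • (spinVec (cliff p u) v + dot8 u v • p) := rfl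

theorem spinPairEnd_mem (u v : ℂ × (Fin 7 → ℂ)) :
    spinPairEnd u v ∈ skewAdjointLieSubalgebra dot7 := by
  rw [mem_skewAdjointLieSubalgebra_iff]
  intro p q
  have h := congrArg (fun a => dot8 a v) (cliff_cliff p q u)
  simp only [map_add, map_smul, LinearMap.add_apply, LinearMap.smul_apply, smul_eq_mul] at h
  rw [dot7_symm _ q]
  simp only [spinPairEnd_apply, map_add, map_smul, smul_eq_mul, dot7_spinVec, dot7_symm q p]
  linear_combination (2 / 3 : ℂ) * h

/-- The map `π₁ : ℂ⁸ × ℂ⁸ → so(7)`. -/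
noncomputable def spinPair : (ℂ × (Fin 7 → ℂ)) →ₗ[ℂ] (ℂ × (Fin 7 → ℂ)) →ₗ[ℂ]
    skewAdjointLieSubalgebra dot7 :=
  LinearMap.mk₂ ℂ (fun u v => ⟨spinPairEnd u v, spinPairEnd_mem u v⟩)
    (fun u u' v => by ext1; simp) (fun c u v => by ext1; simp)
    (fun u v v' => by ext1; simp) (fun c u v => by ext1; simp)

theorem coe_spinPair (u v : ℂ × (Fin 7 → ℂ)) :
    (spinPair u v : Module.End ℂ (Fin 7 → ℂ)) = spinPairEnd u v := rfl

theorem spinPair_skew (u v : ℂ × (Fin 7 → ℂ)) : spinPair u v = -spinPair v u := by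
  ext1
  refine LinearMap.ext fun p => dot7_ext fun q => ?_
  have h1 := dot8_cliff q (cliff p u) v
  have h2 := dot8_cliff p u (cliff q v)
  have h3 := congrArg (fun a => dot8 u a) (cliff_cliff p q v)
  simp only [map_add, map_smul, smul_eq_mul] at h3
  simp only [coe_spinPair, NegMemClass.coe_neg, LinearMap.neg_apply, spinPairEnd_apply, map_add,
    map_smul, map_neg, smul_eq_mul, dot7_spinVec, dot8_symm v u, dot7_symm q p]
  rw [dot8_symm (cliff q (cliff p v)) u]
  linear_combination (2 / 3 : ℂ) * (h1 - h2 + h3)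

section

attribute [local irreducible] cliff spinVec

theorem spinPair_inv (x : skewAdjointLieSubalgebra dot7) (u v : ℂ × (Fin 7 → ℂ)) :
    ⁅x, spinPair u v⁆ = spinPair (spin x u) v + spinPair u (spin x v) := by
  ext1
  refine LinearMap.ext fun p => ?_
  have h1 := spinVec_inv x (cliff p u) v
  have h2 := dot8_spin x u v
  have h3 := congrArg (fun T : Module.End ℂ (ℂ × (Fin 7 → ℂ)) => spinVec (T u) v)
    (spinEnd_cliff x p)
  simp only [LinearMap.sub_apply, Module.End.mul_apply, map_sub, ← spin_apply] at h3
  rw [add_eq_zero_iff_eq_neg] at h2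
  simp only [LieSubalgebra.coe_bracket, LieRing.of_associative_ring_bracket, coe_spinPair,
    LinearMap.sub_apply, Module.End.mul_apply, spinPairEnd_apply, map_add, map_smul,
    AddMemClass.coe_add, LinearMap.add_apply, h2, ← h1, ← h3]
  module

end

theorem spin_spinPair_apply (u v w : ℂ × (Fin 7 → ℂ)) : spin (spinPair u v) w =
    -(1 / 6 : ℂ) • ∑ j, cliff (spinVec (cliff (Pi.single j 1) u) v + dot8 u v • Pi.single j 1)
      (cliff (Pi.single j 1) w) := by
  rw [spin_apply, coe_spinPair, spinEnd_apply]
  simp only [LinearMap.smul_apply, LinearMap.sum_apply, Module.End.mul_apply, spinPairEnd_apply,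
    map_smul, ← Finset.smul_sum, smul_smul]
  norm_num

theorem spinVec_skew (a b : ℂ × (Fin 7 → ℂ)) : spinVec a b = -spinVec b a := by
  rw [spinVec_apply, spinVec_apply, cross7_skew a.2 b.2]
  module

theorem dot8_cliff_self (p : Fin 7 → ℂ) (v : ℂ × (Fin 7 → ℂ)) : dot8 v (cliff p v) = 0 := by
  have h := dot8_cliff p v v
  rw [dot8_symm (cliff p v)] at h
  linear_combination h / 2

theorem cliff_spinVec_self (v a : ℂ × (Fin 7 → ℂ)) :
    cliff (spinVec v a) v = dot8 v v • a - dot8 a v • v := by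
  have h := cross7_cross7 v.2 v.2 a.2
  have h1 : dot7 (cross7 v.2 a.2) v.2 = 0 := by
    rw [dot7_symm, ← dot7_cross7, cross7_self, map_zero, LinearMap.zero_apply]
  simp only [cliff_apply, spinVec_apply, dot8_apply, map_add, map_sub, map_smul,
    LinearMap.add_apply, LinearMap.sub_apply, LinearMap.smul_apply, cross7_self, h1, smul_eq_mul]
  ext1
  · simp only [Prod.fst_sub, Prod.fst_add, Prod.smul_fst, smul_eq_mul]; ring
  · simp only [Prod.snd_sub, Prod.snd_add, Prod.smul_snd]
    rw [cross7_skew (cross7 v.2 a.2) v.2, cross7_skew a.2 v.2]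
    rw [dot7_symm v.2 a.2] at h
    linear_combination (norm := module) (-(1 / 2 : ℂ)) • h

theorem cliff_spinVec (v w a : ℂ × (Fin 7 → ℂ)) :
    cliff (spinVec v a) w + cliff (spinVec w a) v =
      (2 * dot8 v w) • a - dot8 a v • w - dot8 a w • v := by
  have h := cliff_spinVec_self (v + w) a
  simp only [map_add, LinearMap.add_apply, cliff_spinVec_self, dot8_symm w v] at h
  linear_combination (norm := module) h

theorem dot7_single (i j : Fin 7) :
    dot7 (Pi.single i (1 : ℂ)) (Pi.single j 1) = if i = j then 1 else 0 := by
  simp [dot7_apply, Pi.single_apply, eq_comm]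

theorem cliff_single_sq (j : Fin 7) (a : ℂ × (Fin 7 → ℂ)) :
    cliff (Pi.single j 1) (cliff (Pi.single j 1) a) = -a := by
  have h := cliff_cliff (Pi.single j 1) (Pi.single j 1) a
  rw [dot7_single, if_pos rfl] at h
  linear_combination (norm := module) (1 / 2 : ℂ) • h

theorem sum_spinVec (u v : ℂ × (Fin 7 → ℂ)) :
    ∑ j : Fin 7, spinVec (cliff (Pi.single j 1) v) (cliff (Pi.single j 1) u) =
      -(5 : ℂ) • spinVec v u := by
  refine dot7_ext fun p => ?_
  have e : ∀ j : Fin 7, dot8 (cliff p (cliff (Pi.single j 1) v)) (cliff (Pi.single j 1) u) =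
      -dot8 (cliff p v) u + 2 * dot8 (cliff (dot7 p (Pi.single j 1) • Pi.single j 1) v) u := by
    intro j
    have h1 := cliff_cliff p (Pi.single j 1) v
    have h2 := dot8_cliff (Pi.single j 1) (cliff (Pi.single j 1) (cliff p v)) u
    have h3 := dot8_cliff (Pi.single j 1) v u
    rw [cliff_single_sq] at h2
    rw [eq_sub_of_add_eq h1]
    simp only [map_smul, map_sub, map_neg, LinearMap.smul_apply, LinearMap.sub_apply,
      LinearMap.neg_apply, smul_eq_mul] at h2 ⊢
    linear_combination -h2 - 2 * dot7 p (Pi.single j 1) * h3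
  simp only [map_sum, dot7_spinVec, e, map_smul, smul_eq_mul, Finset.sum_add_distrib,
    ← Finset.mul_sum]
  have h := congrArg (fun q => dot8 (cliff q v) u) (sum_dot7_smul p)
  simp only [map_sum, map_smul, LinearMap.sum_apply] at h
  rw [h, Finset.sum_const, Finset.card_univ, Fintype.card_fin]
  simp only [nsmul_eq_mul]
  push_cast
  ring

theorem spin_spinPair_self (u v : ℂ × (Fin 7 → ℂ)) :
    spin (spinPair u v) v = dot8 v v • u - dot8 u v • v := by
  have e : ∀ j : Fin 7, cliff (spinVec (cliff (Pi.single j 1) u) v + dot8 u v • Pi.single j 1)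
      (cliff (Pi.single j 1) v) =
      cliff (spinVec (cliff (Pi.single j 1) v) (cliff (Pi.single j 1) u)) v +
      cliff (dot7 (spinVec u v) (Pi.single j 1) • Pi.single j 1) v := by
    intro j
    have h := cliff_spinVec v (cliff (Pi.single j 1) v) (cliff (Pi.single j 1) u)
    have h1 := dot8_cliff (Pi.single j 1) u (cliff (Pi.single j 1) v)
    rw [cliff_single_sq, map_neg] at h1
    rw [dot8_cliff_self, eq_neg_of_add_eq_zero_left h1] at h
    rw [dot7_symm, dot7_spinVec, spinVec_skew _ v]
    simp only [map_add, map_neg, map_smul, LinearMap.add_apply, LinearMap.neg_apply,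
      LinearMap.smul_apply, cliff_single_sq]
    linear_combination (norm := module) -h
  have h := congrArg (fun q => cliff q v) (sum_dot7_smul (spinVec u v))
  have h' := congrArg (fun q => cliff q v) (sum_spinVec u v)
  simp only [map_sum, LinearMap.sum_apply] at h h'
  rw [spin_spinPair_apply, Finset.sum_congr rfl fun j _ => e j, Finset.sum_add_distrib, h, h',
    spinVec_skew u v, map_smul, LinearMap.smul_apply, map_neg, LinearMap.neg_apply,
    cliff_spinVec_self]
  module

theorem spin_spinPair (u v w : ℂ × (Fin 7 → ℂ)) :
    spin (spinPair u v) w + spin (spinPair u w) v =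
      (2 * dot8 v w) • u - dot8 u v • w - dot8 u w • v := by
  have h := spin_spinPair_self u (v + w)
  simp only [map_add, LinearMap.add_apply, spin_spinPair_self, dot8_symm w v] at h
  linear_combination (norm := module) h

/-- The Lie superalgebra `F(4)`, with even part `so(7) × sl(2)` and odd part `ℂ⁸ ⊗ ℂ²`, where `ℂ⁸`
is the spin representation of `so(7)`. -/
noncomputable def F4 : LieSuperData (skewAdjointLieSubalgebra dot7)
    (skewAdjointLieSubalgebra symplecticForm) (ℂ × (Fin 7 → ℂ)) (Fin 2 → ℂ) where
  ρ₁ := spin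
  ρ₂ := (skewAdjointLieSubalgebra symplecticForm).incl
  ψ₁ := dot8
  ψ₂ := symplecticForm
  π₁ := spinPair
  π₂ := skewMap (ε := -1) (by norm_num) (by simpa using symplecticForm_skew)
  ψ₁_symm := dot8_symm
  ψ₂_skew := symplecticForm_skew
  π₁_skew := spinPair_skew
  π₂_symm u v := by
    simpa using skewMap_comm (ψ := symplecticForm) (ε := -1) (by norm_num)
      (by simpa using symplecticForm_skew) u v
  ψ₁_inv := dot8_spin
  ψ₂_inv := skewAdjoint_apply symplecticForm
  π₁_inv := spinPair_inv
  π₂_inv := lie_skewMap _ _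
  jacobi := by
    refine jacobi_of_rankTwo dot8 (fun u v w => spin (spinPair u v) w) dot8_symm ?_ spin_spinPair
    intro u v w
    rw [spinPair_skew u v, map_neg, LinearMap.neg_apply]

/-! Everything reduces to the rank of one operator. On each factor there is an invariant form for
which the odd map `π` is dual to the action (`IsMomentForm`). Their orthogonal sum `τ` satisfies
`τ(z, [a, b]) = ψ(z·a, b)`, with `ψ = ψ₁ ⊗ ψ₂` nondegenerate on `𝔤₁`. If elements of `S(𝔤₀)` are
evaluated by means of `τ`, the bracket matrix at `z` therefore has the rank of the action of `z` on
`𝔤₁`.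

An arbitrary `Φ` has the form `τ(A·, ·)` with `A` invertible and commuting with the adjoint action,
so the rank at `z` is that of the action of `A z`. Such an `A` need not be scalar on the two
factors, for instance on `so(4)`. The given nilpotent `z = (x, y)` is `τ`-orthogonal to its
centralizer, so `z = [h, z]` for some `h`; hence `exp (ad (C h)) z = exp(C) z` for every `C` in the
centroid. Writing `A` through exponentials shows that `z` and `A z` act on `𝔤₁` with the same rank
(`finrank_range_of_mem_lieCentroid`).

The adjoint group acts by conjugation, so the rank is constant on the orbit. The orbit is
irreducible, because its generators lie on polynomial curves; so its ideal is prime. A rank that is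
constant on the orbit is also the rank over the fraction field (`rank_map_fractionRing_quotient`).

It remains to compute the rank of `x ⊗ 1 + 1 ⊗ y`. Jordan blocks of sizes `s` and `t` contribute
`min s t` to its kernel (`finrank_ker_tensor`), and `min s t` counts the `k ≥ 1` with `k ≤ s` and `k
≤ t`; summing over the blocks gives `∑ μ'_k ν'_k`. The three families enter only through their
moment forms, which are multiples of trace forms. -/

/-! ### The ideal of an orbit is prime -/

/-- Functions whose restriction to every polynomial curve is polynomial. -/
def PolynomialOnCurves {M : Type*} [AddCommGroup M] [Module ℂ M] (F : M → ℂ) : Prop :=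
  ∀ (N : ℕ) (c : ℕ → M), ∃ p : Polynomial ℂ, ∀ t : ℂ,
    p.eval t = F (∑ k ∈ Finset.range N, t ^ k • c k)

theorem PolynomialOnCurves.comp_linear {M : Type*} [AddCommGroup M] [Module ℂ M] {F : M → ℂ}
    (hF : PolynomialOnCurves F) (e : M →ₗ[ℂ] M) : PolynomialOnCurves fun z => F (e z) := by
  intro N c
  obtain ⟨p, hp⟩ := hF N fun k => e (c k)
  exact ⟨p, fun t => by simp [hp]⟩

theorem polynomialOnCurves_evalAt {𝔤₀ : Type*} [LieRing 𝔤₀] [LieAlgebra ℂ 𝔤₀]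
    (Φ : LinearMap.BilinForm ℂ 𝔤₀) (f : SymmetricAlgebra ℂ 𝔤₀) :
    PolynomialOnCurves fun z => evalAt Φ z f := by
  intro N c
  induction f using SymmetricAlgebra.induction with
  | algebraMap r => exact ⟨Polynomial.C r, fun t => by simp⟩
  | ι a =>
    refine ⟨∑ k ∈ Finset.range N, Polynomial.X ^ k * Polynomial.C (Φ (c k) a), fun t => ?_⟩
    simp only [evalAt, Polynomial.eval_finsetSum, Polynomial.eval_mul, Polynomial.eval_pow,
      Polynomial.eval_X, Polynomial.eval_C, SymmetricAlgebra.lift_ι_apply, map_sum, map_smul,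
      LinearMap.sum_apply, LinearMap.smul_apply, smul_eq_mul]
  | mul f g hf hg =>
    obtain ⟨p, hp⟩ := hf
    obtain ⟨q, hq⟩ := hg
    exact ⟨p * q, fun t => by simp [hp, hq]⟩
  | add f g hf hg =>
    obtain ⟨p, hp⟩ := hf
    obtain ⟨q, hq⟩ := hg
    exact ⟨p + q, fun t => by simp [hp, hq]⟩

/-- The sum is 1 plus a multiple of `a` by an element commuting with `a`, hence 1 plus a nilpotent.
-/
theorem isUnit_sum_of_pow_eq_zero {A : Type*} [Ring A] [Algebra ℂ A] {a : A} {N : ℕ}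
    (h : a ^ N = 0) : IsUnit (∑ k ∈ Finset.range N, (k.factorial : ℂ)⁻¹ • a ^ k) := by
  cases N with
  | zero =>
    have : Subsingleton A := subsingleton_of_zero_eq_one (by simpa using h.symm)
    exact isUnit_of_subsingleton _
  | succ N =>
    rw [Finset.sum_range_succ']
    simp only [pow_zero, Nat.factorial_zero, Nat.cast_one, inv_one, one_smul]
    refine IsNilpotent.isUnit_add_one ⟨N + 1, ?_⟩
    have : ∑ k ∈ Finset.range N, ((k + 1).factorial : ℂ)⁻¹ • a ^ (k + 1) =
        a * ∑ k ∈ Finset.range N, ((k + 1).factorial : ℂ)⁻¹ • a ^ k := by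
      simp [Finset.mul_sum, pow_succ']
    have hc : Commute a (∑ k ∈ Finset.range N, ((k + 1).factorial : ℂ)⁻¹ • a ^ k) :=
      Commute.sum_right _ _ _ fun k _ => ((Commute.refl a).pow_right k).smul_right _
    rw [this, hc.mul_pow, h, zero_mul]

/-- Rescaling `n` to `t • n` puts every generator on a curve in the group that is polynomial in `t`
and passes through the identity at `t = 0`. -/
theorem exists_mem_adjointGroup {𝔨 : Type*} [LieRing 𝔨] [LieAlgebra ℂ 𝔨] {n : 𝔨} {N : ℕ}
    (h : (LieAlgebra.ad ℂ 𝔨 n) ^ N = 0) (t : ℂ) :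
    ∃ e ∈ adjointGroup 𝔨, ∀ z, e z =
      ∑ k ∈ Finset.range N, t ^ k • (k.factorial : ℂ)⁻¹ • ((LieAlgebra.ad ℂ 𝔨 n) ^ k) z := by
  have ht : (LieAlgebra.ad ℂ 𝔨 (t • n)) ^ N = 0 := by rw [map_smul, smul_pow, h, smul_zero]
  have hu := (Module.End.isUnit_iff _).1 (isUnit_sum_of_pow_eq_zero ht)
  refine ⟨LinearEquiv.ofBijective _ hu, Subgroup.subset_closure ⟨t • n, N, ht, fun z => ?_⟩,
    fun z => ?_⟩
  · simp [LinearMap.sum_apply]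
  · simp only [LinearEquiv.ofBijective_apply, map_smul, smul_pow, LinearMap.sum_apply,
      LinearMap.smul_apply, smul_smul, mul_comm]

/-- This is the irreducibility of the orbit. For a generator, `F` and `G` restrict to nonzero
polynomials on the curve `exp (t ad n) z`, so their product is nonzero at some `t`. Quantifying over
`F`, `G` and `z` makes the claim stable under products and inverses in the group. -/
theorem exists_ne_zero_of_mem_adjointGroup {𝔨 : Type*} [LieRing 𝔨] [LieAlgebra ℂ 𝔨]
    {e : 𝔨 ≃ₗ[ℂ] 𝔨} (he : e ∈ adjointGroup 𝔨) :
    ∀ (F G : 𝔨 → ℂ) (_ : PolynomialOnCurves F) (_ : PolynomialOnCurves G) (z : 𝔨),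
      F z ≠ 0 → G (e z) ≠ 0 → ∃ e' ∈ adjointGroup 𝔨, F (e' z) ≠ 0 ∧ G (e' z) ≠ 0 := by
  induction he using Subgroup.closure_induction with
  | mem e he =>
    obtain ⟨n, N, hN, hn⟩ := he
    intro F G hF hG z hFz hGz
    obtain ⟨p, hp⟩ := hF N fun k => (k.factorial : ℂ)⁻¹ • ((LieAlgebra.ad ℂ 𝔨 n) ^ k) z
    obtain ⟨q, hq⟩ := hG N fun k => (k.factorial : ℂ)⁻¹ • ((LieAlgebra.ad ℂ 𝔨 n) ^ k) z
    have hp0 : p ≠ 0 := by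
      rintro rfl
      refine hFz ?_
      have := hp 0
      rw [Polynomial.eval_zero] at this
      rw [this]
      congr 1
      -- At `t = 0` only the constant term `z` is left. If `N = 0`, then `1 = 0` on `𝔨` and both
      -- sides are evaluated at zero.
      cases N with
      | zero =>
        have := congrArg (fun T : Module.End ℂ 𝔨 => T z) hN
        simpa using this
      | succ N => simp [Finset.sum_range_succ']
    have hq0 : q ≠ 0 := by
      rintro rfl
      have := hq 1
      simp only [one_pow, one_smul, ← hn, Polynomial.eval_zero] at this
      exact hGz this.symm
    obtain ⟨t, ht⟩ : ∃ t, (p * q).eval t ≠ 0 := by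
      by_contra! H
      exact mul_ne_zero hp0 hq0 (Polynomial.funext fun t => by simp [H t])
    rw [Polynomial.eval_mul, hp, hq] at ht
    obtain ⟨e', he', h'⟩ := exists_mem_adjointGroup hN t
    refine ⟨e', he', ?_, ?_⟩
    · rw [h']; exact left_ne_zero_of_mul ht
    · rw [h']; exact right_ne_zero_of_mul ht
  | one => exact fun F G _ _ z hFz hGz => ⟨1, one_mem _, hFz, hGz⟩
  | mul a b _ _ iha ihb =>
    intro F G hF hG z hFz hGz
    -- The path is split at an intermediate point: first `c z` is found with `F (c z)` and `G (a (c
    -- z))` nonzero, then `a` is treated with base point `c z`.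
    obtain ⟨c, hc, h1, h2⟩ := ihb F (fun w => G (a w)) hF (hG.comp_linear a.toLinearMap) z hFz hGz
    obtain ⟨d, hd, h3, h4⟩ := iha F G hF hG (c z) h1 h2
    exact ⟨d * c, mul_mem hd hc, h3, h4⟩
  | inv a ha ih =>
    intro F G hF hG z hFz hGz
    -- The path is run backwards, from `a⁻¹ z` to `z`, with `F` and `G` exchanged.
    obtain ⟨c, hc, h1, h2⟩ := ih G F hG hF (a⁻¹ z) hGz (by
      have : a (a⁻¹ z) = z := a.apply_symm_apply z
      rwa [this])
    exact ⟨c * a⁻¹, mul_mem hc (inv_mem ha), h2, h1⟩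

theorem mem_idealOfSet {𝔤₀ : Type*} [LieRing 𝔤₀] [LieAlgebra ℂ 𝔤₀]
    {Φ : LinearMap.BilinForm ℂ 𝔤₀} {O : Set 𝔤₀} {f : SymmetricAlgebra ℂ 𝔤₀} :
    f ∈ idealOfSet Φ O ↔ ∀ z ∈ O, evalAt Φ z f = 0 := by
  simp [idealOfSet, RingHom.mem_ker]

theorem isPrime_idealOfSet_adjointOrbit {𝔤₀ : Type*} [LieRing 𝔤₀] [LieAlgebra ℂ 𝔤₀]
    (Φ : LinearMap.BilinForm ℂ 𝔤₀) (z : 𝔤₀) : (idealOfSet Φ (adjointOrbit z)).IsPrime := by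
  refine ⟨fun h => ?_, fun {f g} hfg => ?_⟩
  · have : (1 : SymmetricAlgebra ℂ 𝔤₀) ∈ idealOfSet Φ (adjointOrbit z) := h ▸ Submodule.mem_top
    have := mem_idealOfSet.1 this z ⟨1, one_mem _, rfl⟩
    simp at this
  · by_contra! H
    simp only [mem_idealOfSet, not_forall] at H
    obtain ⟨⟨_, ⟨a, ha, rfl⟩, h1⟩, ⟨_, ⟨b, hb, rfl⟩, h2⟩⟩ := H
    have e1 : (b * a⁻¹) (a z) = b z := congrArg b (a.symm_apply_apply z)
    obtain ⟨c, hc, h3, h4⟩ := exists_ne_zero_of_mem_adjointGroup (mul_mem hb (inv_mem ha))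
      _ _ (polynomialOnCurves_evalAt Φ f) (polynomialOnCurves_evalAt Φ g) (a z) h1
      (by rwa [e1])
    have := mem_idealOfSet.1 hfg (c (a z)) ⟨c * a, mul_mem hc ha, rfl⟩
    rw [map_mul] at this
    exact mul_ne_zero h3 h4 this

/-! ### The rank over the fraction field -/

/-- The matrices `P` and `Q` cut the identity block out of the rank normal form. Together with
`Matrix.le_rank_of_det_ne_zero` this turns a lower bound on the rank into one nonvanishing
determinant, which can be moved between rings. -/
theorem Matrix.exists_mul_mul_eq_one {K ι : Type*} [Field K] [Fintype ι] (M : Matrix ι ι K) :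
    ∃ (P : Matrix (Fin M.rank) ι K) (Q : Matrix ι (Fin M.rank) K), P * M * Q = 1 := by
  classical
  obtain ⟨V, U, e, -, -, h⟩ := M.exists_rank_normal_form
  refine ⟨V.submatrix (e.symm ∘ Sum.inl) id, U.submatrix id (e.symm ∘ Sum.inl), ?_⟩
  have := congrArg (fun A => A.submatrix (e.symm ∘ Sum.inl) (e.symm ∘ Sum.inl)) h
  ext i j
  have := congrFun (congrFun this i) j
  simpa [Matrix.mul_apply, Matrix.one_apply] using this

theorem Matrix.le_rank_of_det_ne_zero {K ι : Type*} [Field K] [Fintype ι] {M : Matrix ι ι K}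
    {r : ℕ} (P : Matrix (Fin r) ι K) (Q : Matrix ι (Fin r) K) (h : (P * M * Q).det ≠ 0) :
    r ≤ M.rank := by
  have := Matrix.rank_of_det_ne_zero h
  rw [Fintype.card_fin] at this
  rw [← this]
  exact (Matrix.rank_mul_le_left _ _).trans (Matrix.rank_mul_le_right _ _)

theorem Matrix.exists_smul_eq_map {S K m n : Type*} [CommRing S] [IsDomain S] [Field K]
    [Algebra S K] [IsFractionRing S K] [Finite m] [Finite n] (P : Matrix m n K) :
    ∃ (d : S) (P' : Matrix m n S), d ≠ 0 ∧ P'.map (algebraMap S K) = algebraMap S K d • P := by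
  obtain ⟨b, hb⟩ := IsLocalization.exist_integer_multiples_of_finite (nonZeroDivisors S)
    (fun x : m × n => P x.1 x.2)
  choose f hf using hb
  refine ⟨b, Matrix.of fun i j => f (i, j), nonZeroDivisors.ne_zero b.2, ?_⟩
  ext i j
  simp [hf, Algebra.smul_def]

/-- A determinant is nonzero in the fraction field exactly when it is nonzero at some point.
Witnesses over the fraction field, cleared of denominators and lifted to `S`, bound the rank there
by the rank at some point; this is where constancy is needed. Constant witnesses at `x₀` give the
reverse inequality. -/
theorem rank_map_fractionRing_quotient {S ι X : Type*} [CommRing S] [Algebra ℂ S] [Fintype ι]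
    (q : Ideal S) [q.IsPrime] (φ : X → S →ₐ[ℂ] ℂ) (hmem : ∀ f, f ∈ q ↔ ∀ x, φ x f = 0) (M : Matrix ι ι S) (x₀ : X)
    (h : ∀ x, (M.map (φ x)).rank = (M.map (φ x₀)).rank) :
    (M.map (algebraMap S (FractionRing (S ⧸ q)))).rank = (M.map (φ x₀)).rank := by
  set K := FractionRing (S ⧸ q)
  have halg : ∀ f, algebraMap S K f = algebraMap (S ⧸ q) K (Ideal.Quotient.mk q f) := fun _ => rfl
  have hker : ∀ f, algebraMap S K f = 0 ↔ f ∈ q := fun f => by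
    rw [halg, map_eq_zero_iff _ (IsFractionRing.injective (S ⧸ q) K),
      Ideal.Quotient.eq_zero_iff_mem]
  apply le_antisymm
  · obtain ⟨r, hr, P, Q, hPQ⟩ : ∃ r, r = (M.map (algebraMap S K)).rank ∧
        ∃ (P : Matrix (Fin r) ι K) (Q : Matrix ι (Fin r) K), P * M.map (algebraMap S K) * Q = 1 :=
      ⟨_, rfl, (M.map (algebraMap S K)).exists_mul_mul_eq_one⟩
    rw [← hr]
    obtain ⟨a, P₁, ha, hP₁⟩ := Matrix.exists_smul_eq_map (S := S ⧸ q) P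
    obtain ⟨b, Q₁, hb, hQ₁⟩ := Matrix.exists_smul_eq_map (S := S ⧸ q) Q
    obtain ⟨a', rfl⟩ := Ideal.Quotient.mk_surjective a
    obtain ⟨b', rfl⟩ := Ideal.Quotient.mk_surjective b
    choose P₂ hP₂ using fun i j => Ideal.Quotient.mk_surjective (P₁ i j)
    choose Q₂ hQ₂ using fun i j => Ideal.Quotient.mk_surjective (Q₁ i j)
    have hP₃ : (Matrix.of P₂).map (algebraMap S K) = algebraMap S K a' • P := by
      rw [halg a', ← hP₁]
      ext i j
      simp [halg, hP₂]
    have hQ₃ : (Matrix.of Q₂).map (algebraMap S K) = algebraMap S K b' • Q := by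
      rw [halg b', ← hQ₁]
      ext i j
      simp [halg, hQ₂]
    have hdet : algebraMap S K (Matrix.of P₂ * M * Matrix.of Q₂).det ≠ 0 := by
      rw [RingHom.map_det, RingHom.mapMatrix_apply, Matrix.map_mul, Matrix.map_mul, hP₃, hQ₃,
        Matrix.smul_mul, Matrix.smul_mul, Matrix.mul_smul, hPQ, smul_smul, Matrix.det_smul,
        Matrix.det_one, mul_one]
      refine pow_ne_zero _ (mul_ne_zero ?_ ?_)
      · rwa [Ne, hker, ← Ideal.Quotient.eq_zero_iff_mem]
      · rwa [Ne, hker, ← Ideal.Quotient.eq_zero_iff_mem]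
    rw [Ne, hker, hmem] at hdet
    push Not at hdet
    obtain ⟨x, hne⟩ := hdet
    rw [← h x]
    rw [AlgHom.map_det, AlgHom.mapMatrix_apply, Matrix.map_mul, Matrix.map_mul] at hne
    exact Matrix.le_rank_of_det_ne_zero _ _ hne
  · obtain ⟨P, Q, hPQ⟩ := (M.map (φ x₀)).exists_mul_mul_eq_one
    have hdet : algebraMap S K (P.map (algebraMap ℂ S) * M * Q.map (algebraMap ℂ S)).det ≠ 0 := by
      rw [Ne, hker, hmem]
      intro H
      have := H x₀
      rw [AlgHom.map_det, AlgHom.mapMatrix_apply, Matrix.map_mul, Matrix.map_mul, Matrix.map_map,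
        Matrix.map_map] at this
      have e : φ x₀ ∘ algebraMap ℂ S = id := funext fun c => (φ x₀).commutes c
      rw [e, Matrix.map_id, Matrix.map_id, hPQ, Matrix.det_one] at this
      exact one_ne_zero this
    rw [RingHom.map_det, RingHom.mapMatrix_apply, Matrix.map_mul, Matrix.map_mul] at hdet
    exact Matrix.le_rank_of_det_ne_zero _ _ hdet

/-! ### Exponentials and conjugation -/

/-- Left and right multiplications commute, so the binomial theorem applies. -/
theorem mulLeft_sub_mulRight_pow {A : Type*} [Ring A] [Algebra ℂ A] (n x : A) (k : ℕ) :
    ((LinearMap.mulLeft ℂ n - LinearMap.mulRight ℂ n) ^ k) x =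
      ∑ m ∈ Finset.HasAntidiagonal.antidiagonal k, k.choose m.1 • (n ^ m.1 * (x * (-n) ^ m.2)) := by
  have hc : Commute (LinearMap.mulLeft ℂ n) (LinearMap.mulRight ℂ (-n)) :=
    LinearMap.ext fun y => by simp [mul_assoc]
  have : LinearMap.mulLeft ℂ n - LinearMap.mulRight ℂ n =
      LinearMap.mulLeft ℂ n + LinearMap.mulRight ℂ (-n) :=
    LinearMap.ext fun y => by simp [sub_eq_add_neg]
  rw [this, hc.add_pow']
  simp [LinearMap.sum_apply, LinearMap.pow_mulLeft, LinearMap.pow_mulRight]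

/-- The Cauchy product of the two exponential series, grouped by total degree, is the series of `exp
(ad n) x`. -/
theorem hasSum_exp_mul_mul_exp_neg {A : Type*} [NormedRing A] [NormedAlgebra ℂ A]
    [CompleteSpace A] (n x : A) :
    HasSum (fun k : ℕ => (k.factorial : ℂ)⁻¹ •
      ((LinearMap.mulLeft ℂ n - LinearMap.mulRight ℂ n) ^ k) x)
      (NormedSpace.exp n * (x * NormedSpace.exp (-n))) := by
  set f : ℕ → A := fun k => (k.factorial : ℂ)⁻¹ • n ^ k
  set g : ℕ → A := fun k => x * ((k.factorial : ℂ)⁻¹ • (-n) ^ k)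
  have hf : HasSum f (NormedSpace.exp n) := NormedSpace.exp_series_hasSum_exp' n
  have hg : HasSum g (x * NormedSpace.exp (-n)) :=
    (NormedSpace.exp_series_hasSum_exp' (𝕂 := ℂ) (-n)).mul_left x
  have hf' : Summable fun k => ‖f k‖ := NormedSpace.norm_expSeries_summable' n
  have hg' : Summable fun k => ‖g k‖ :=
    Summable.of_nonneg_of_le (fun _ => norm_nonneg _) (fun _ => norm_mul_le _ _)
      ((NormedSpace.norm_expSeries_summable' (𝕂 := ℂ) (-n)).mul_left ‖x‖)
  have h1 := (summable_norm_sum_mul_antidiagonal_of_summable_norm hf' hg').of_norm.hasSum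
  rw [← tsum_mul_tsum_eq_tsum_sum_antidiagonal_of_summable_norm hf' hg', hf.tsum_eq,
    hg.tsum_eq] at h1
  refine (congrArg (fun F => HasSum F _) (funext fun k => ?_)).mpr h1
  rw [mulLeft_sub_mulRight_pow, Finset.smul_sum]
  refine Finset.sum_congr rfl fun m hm => ?_
  have hk : (k.factorial : ℂ)⁻¹ * (k.choose m.1 : ℂ) =
      (m.1.factorial : ℂ)⁻¹ * (m.2.factorial : ℂ)⁻¹ := by
    rw [← Finset.HasAntidiagonal.mem_antidiagonal.1 hm, Nat.choose_symm_add, Nat.add_choose,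
      Nat.cast_div (Nat.factorial_mul_factorial_dvd_factorial_add _ _)
        (by exact_mod_cast (Nat.mul_pos (Nat.factorial_pos _) (Nat.factorial_pos _)).ne')]
    have := Nat.factorial_ne_zero (m.1 + m.2)
    push_cast
    field_simp
  simp only [f, g, smul_mul_assoc, mul_smul_comm, smul_smul, ← Nat.cast_smul_eq_nsmul ℂ]
  rw [hk, mul_comm]

theorem LinearMap.finrank_range_eq_rank_toMatrix {W n : Type*} [AddCommGroup W] [Module ℂ W]
    [Fintype n] [DecidableEq n] (b : Module.Basis n ℂ W) (T : Module.End ℂ W) :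
    Module.finrank ℂ (LinearMap.range T) = (LinearMap.toMatrix b b T).rank := by
  rw [Matrix.rank_eq_finrank_range_toLin _ b b, Matrix.toLin_toMatrix]

section Representation

variable {𝔨 W : Type*} [LieRing 𝔨] [LieAlgebra ℂ 𝔨] [AddCommGroup W] [Module ℂ W]
  [FiniteDimensional ℂ W] (ρ : 𝔨 →ₗ⁅ℂ⁆ Module.End ℂ W)

/-- The operator norm is opened only in the proof term; the statement uses the entrywise topology.
-/
theorem Matrix.hasSum_exp_mul_mul_exp_neg {m : Type*} [Fintype m] [DecidableEq m]
    (n x : Matrix m m ℂ) :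
    HasSum (fun k : ℕ => (k.factorial : ℂ)⁻¹ •
      ((LinearMap.mulLeft ℂ n - LinearMap.mulRight ℂ n) ^ k) x)
      (NormedSpace.exp n * (x * NormedSpace.exp (-n))) :=
  open scoped Matrix.Norms.Operator in _root_.hasSum_exp_mul_mul_exp_neg n x

/-- If `w = exp (ad n) z`, where the series converges weakly, then `ρ w` and `ρ z` are
conjugate, so they have the same rank. -/
theorem finrank_range_of_hasSum_ad {n z w : 𝔨}
    (h : ∀ f : 𝔨 →ₗ[ℂ] ℂ, HasSum
      (fun k : ℕ => (k.factorial : ℂ)⁻¹ * f ((LieAlgebra.ad ℂ 𝔨 n ^ k) z)) (f w)) :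
    Module.finrank ℂ (LinearMap.range (ρ w)) = Module.finrank ℂ (LinearMap.range (ρ z)) := by
  set b := Module.finBasis ℂ W
  set M : 𝔨 →ₗ[ℂ] Matrix _ _ ℂ := (LinearMap.toMatrix b b).toLinearMap ∘ₗ ρ.toLinearMap with hM
  have hlie : ∀ x y, M ⁅x, y⁆ = M x * M y - M y * M x := by
    intro x y
    simp [hM, LieRing.of_associative_ring_bracket, LinearMap.toMatrix_mul]
  have hpow : ∀ k, M ((LieAlgebra.ad ℂ 𝔨 n ^ k) z) =
      ((LinearMap.mulLeft ℂ (M n) - LinearMap.mulRight ℂ (M n)) ^ k) (M z) := by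
    intro k
    induction k with
    | zero => simp
    | succ k ih => simp [pow_succ', hlie, ← ih]
  have h1 : HasSum (fun k : ℕ => (k.factorial : ℂ)⁻¹ •
      ((LinearMap.mulLeft ℂ (M n) - LinearMap.mulRight ℂ (M n)) ^ k) (M z)) (M w) := by
    -- Each matrix entry of `M` is a linear functional on `𝔨`, so weak convergence is enough.
    refine Pi.hasSum.2 fun i => Pi.hasSum.2 fun j => ?_
    have := h (Matrix.entryLinearMap ℂ ℂ i j ∘ₗ M)
    simpa [hpow] using this
  have h2 := h1.unique (Matrix.hasSum_exp_mul_mul_exp_neg (M n) (M z))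
  have u1 := (Matrix.isUnit_iff_isUnit_det _).1 (Matrix.isUnit_exp (M n))
  have u2 := (Matrix.isUnit_iff_isUnit_det _).1 (Matrix.isUnit_exp (-M n))
  rw [LinearMap.finrank_range_eq_rank_toMatrix b, LinearMap.finrank_range_eq_rank_toMatrix b]
  change (M w).rank = (M z).rank
  rw [h2, Matrix.rank_mul_eq_right_of_isUnit_det _ _ u1,
    Matrix.rank_mul_eq_left_of_isUnit_det _ _ u2]

/-- `E` is the exponential of `C`, where the exponential series converges weakly. -/
def IsExp {M : Type*} [AddCommGroup M] [Module ℂ M] (C E : Module.End ℂ M) : Prop :=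
  ∀ (z : M) (f : M →ₗ[ℂ] ℂ), HasSum (fun k : ℕ => (k.factorial : ℂ)⁻¹ * f ((C ^ k) z)) (f (E z))

theorem isExp_of_pow_eq_zero {M : Type*} [AddCommGroup M] [Module ℂ M] {C : Module.End ℂ M}
    {N : ℕ} (h : C ^ N = 0) : IsExp C (∑ k ∈ Finset.range N, (k.factorial : ℂ)⁻¹ • C ^ k) := by
  intro z f
  have : f ((∑ k ∈ Finset.range N, (k.factorial : ℂ)⁻¹ • C ^ k) z) =
      ∑ k ∈ Finset.range N, (k.factorial : ℂ)⁻¹ * f ((C ^ k) z) := by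
    simp [LinearMap.sum_apply]
  rw [this]
  refine hasSum_sum_of_ne_finset_zero fun k hk => ?_
  rw [pow_eq_zero_of_le (by simpa using hk) h]
  simp

theorem finrank_range_of_mem_adjointGroup {e : 𝔨 ≃ₗ[ℂ] 𝔨} (he : e ∈ adjointGroup 𝔨) (z : 𝔨) :
    Module.finrank ℂ (LinearMap.range (ρ (e z))) = Module.finrank ℂ (LinearMap.range (ρ z)) := by
  induction he using Subgroup.closure_induction generalizing z with
  | mem e he =>
    obtain ⟨n, N, hN, hn⟩ := he
    refine finrank_range_of_hasSum_ad ρ (n := n) fun f => ?_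
    have := isExp_of_pow_eq_zero hN z f
    rw [hn]
    simpa [LinearMap.sum_apply] using this
  | one => rfl
  | mul a b _ _ iha ihb => exact (iha _).trans (ihb _)
  | inv a _ ih =>
    have := ih (a⁻¹ z)
    rwa [show a (a⁻¹ z) = z from a.apply_symm_apply z, eq_comm] at this

/-! ### Endomorphisms commuting with the adjoint representation -/

/-- The centroid of a Lie algebra: the endomorphisms that commute with the adjoint action. -/
def lieCentroid (𝔨 : Type*) [LieRing 𝔨] [LieAlgebra ℂ 𝔨] : Subalgebra ℂ (Module.End ℂ 𝔨) :=
  Subalgebra.centralizer ℂ (Set.range (LieAlgebra.ad ℂ 𝔨))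

theorem mem_lieCentroid {A : Module.End ℂ 𝔨} :
    A ∈ lieCentroid 𝔨 ↔ ∀ x y : 𝔨, A ⁅x, y⁆ = ⁅x, A y⁆ := by
  rw [lieCentroid, Subalgebra.mem_centralizer_iff, Set.forall_mem_range]
  refine forall_congr' fun x => ?_
  rw [LinearMap.ext_iff]
  exact forall_congr' fun y => eq_comm

/-- By skew symmetry of the bracket, `A` can be pulled out of the first slot as well as the second.
-/
theorem lieCentroid_apply_lie {A : Module.End ℂ 𝔨} (hA : A ∈ lieCentroid 𝔨) (x y : 𝔨) :
    ⁅A x, y⁆ = A ⁅x, y⁆ := by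
  rw [← lie_skew, ← mem_lieCentroid.1 hA, ← map_neg, lie_skew]

/-- From `[C h, C ^ k z] = C ^ (k + 1) [h, z] = C ^ (k + 1) z` it follows that `ad (C h)` and `C`
have the same powers on `z`. Hence `E z = exp (ad (C h)) z`, and conjugation preserves the rank. -/
theorem finrank_range_of_isExp {C E : Module.End ℂ 𝔨} (hC : C ∈ lieCentroid 𝔨) (hE : IsExp C E)
    {h z : 𝔨} (hz : ⁅h, z⁆ = z) :
    Module.finrank ℂ (LinearMap.range (ρ (E z))) = Module.finrank ℂ (LinearMap.range (ρ z)) := by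
  refine finrank_range_of_hasSum_ad ρ (n := C h) fun f => ?_
  have : ∀ k, (LieAlgebra.ad ℂ 𝔨 (C h) ^ k) z = (C ^ k) z := by
    intro k
    induction k with
    | zero => rfl
    | succ k ih =>
      rw [pow_succ', Module.End.mul_apply, ih, LieAlgebra.ad_apply, lieCentroid_apply_lie hC,
        ← mem_lieCentroid.1 (pow_mem hC k), hz, pow_succ', Module.End.mul_apply]
  simpa [this] using hE z f

/-- Applying `exp (-N)` does not change the rank and replaces `1 + N` by `1 + N² (…)`. The new
nilpotent part has a smaller nilpotency bound, so induction replaces a logarithm. -/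
theorem finrank_range_of_unipotent (m : ℕ) {N : Module.End ℂ 𝔨} (hN : N ∈ lieCentroid 𝔨)
    (hm : N ^ (m + 1) = 0) {h z : 𝔨} (hz : ⁅h, z⁆ = z) :
    Module.finrank ℂ (LinearMap.range (ρ ((1 + N) z))) =
      Module.finrank ℂ (LinearMap.range (ρ z)) := by
  induction m generalizing N with
  | zero =>
    have : N = 0 := by simpa using hm
    rw [this, add_zero, Module.End.one_apply]
  | succ m ih =>
    have hw : ⁅h, (1 + N) z⁆ = (1 + N) z := by
      rw [← mem_lieCentroid.1 (add_mem (one_mem _) hN), hz]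
    have hm' : (-N) ^ (m + 2) = 0 := by rw [neg_pow, hm, mul_zero]
    rw [← finrank_range_of_isExp ρ (neg_mem hN) (isExp_of_pow_eq_zero hm') hw]
    -- `G` is the Taylor remainder in `exp (-N) = 1 - N + N² G`.
    set G := ∑ k ∈ Finset.range m, ((k + 2).factorial : ℂ)⁻¹ • (-N) ^ k with hG
    have hGmem : G ∈ lieCentroid 𝔨 :=
      sum_mem fun k _ => Subalgebra.smul_mem _ (pow_mem (neg_mem hN) _) _
    have hGc : Commute N G := Commute.sum_right _ _ _ fun k _ =>
      (((Commute.refl N).neg_right).pow_right k).smul_right _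
    have e1 : ∑ k ∈ Finset.range (m + 2), (k.factorial : ℂ)⁻¹ • (-N) ^ k = 1 - N + N ^ 2 * G := by
      rw [Finset.sum_range_succ', Finset.sum_range_succ', hG, Finset.mul_sum]
      have : ∀ k : ℕ, (-N) ^ (k + 1 + 1) = N ^ 2 * (-N) ^ k := fun k => by
        rw [add_assoc, pow_add, (Commute.refl _).pow_pow, neg_sq]
      simp only [this, mul_smul_comm, zero_add, pow_one, pow_zero, Nat.factorial_one,
        Nat.factorial_zero, Nat.cast_one, inv_one, one_smul, add_assoc, Nat.reduceAdd]
      rw [add_comm, add_comm (-N), ← sub_eq_add_neg]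
    have e2 : (1 - N + N ^ 2 * G) * (1 + N) = 1 + N ^ 2 * (G * (1 + N) - 1) := by
      noncomm_ring
    rw [← Module.End.mul_apply, e1, e2]
    refine ih (mul_mem (pow_mem hN 2) (sub_mem (mul_mem hGmem (add_mem (one_mem _) hN))
      (one_mem _))) ?_
    have hc : Commute (N ^ 2) (G * (1 + N) - 1) :=
      ((hGc.mul_right ((Commute.one_right N).add_right (Commute.refl N))).sub_right
        (Commute.one_right N)).pow_left 2
    rw [hc.mul_pow, ← pow_mul, pow_eq_zero_of_le (by lia) hm, zero_mul]

/-- The logarithm is `p(S)`, where `p` interpolates `Complex.log` at the roots of the minimal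
polynomial. It acts as `log l` on the `l`-eigenspace, and the eigenspaces span. Being a polynomial
in `S`, it stays in every subalgebra that contains `S`. -/
theorem exists_isExp_of_isSemisimple {M : Type*} [AddCommGroup M] [Module ℂ M]
    [FiniteDimensional ℂ M] {S : Module.End ℂ M} (hS : S.IsSemisimple) (hu : IsUnit S) :
    ∃ C ∈ Algebra.adjoin ℂ {S}, IsExp C S := by
  classical
  set s := (minpoly ℂ S).roots.toFinset
  set p := Lagrange.interpolate s id Complex.log
  refine ⟨Polynomial.aeval S p, Polynomial.aeval_mem_adjoin_singleton ℂ S, ?_⟩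
  intro z
  have hz : z ∈ ⨆ l, S.eigenspace l := by
    rw [(hS.iSup_maxGenEigenspace_eq_top_iff).1 (Module.End.iSup_maxGenEigenspace_eq_top S)]
    trivial
  induction hz using Submodule.iSup_induction' with
  | zero => intro f; simp
  | add x y _ _ hx hy =>
    intro f
    have := (hx f).add (hy f)
    simpa [mul_add] using this
  | mem l v hv =>
    intro f
    by_cases hv0 : v = 0
    · subst hv0; simp
    have hev : S.HasEigenvector l v := ⟨hv, hv0⟩
    have hl : l ≠ 0 := by
      rintro rfl
      have h1 := hev.apply_eq_smul
      rw [zero_smul] at h1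
      exact hv0 (((Module.End.isUnit_iff S).1 hu).1 (by rw [h1, map_zero]))
    have hls : l ∈ s := by
      simp only [s, Multiset.mem_toFinset]
      exact (Polynomial.mem_roots (minpoly.ne_zero_of_finite ℂ S)).2
        (Module.End.isRoot_of_hasEigenvalue (Module.End.hasEigenvalue_of_hasEigenvector hev))
    have hp : p.eval l = Complex.log l := Lagrange.eval_interpolate_at_node (v := id) _
      (Set.injOn_id _) hls
    have hpow : ∀ k, (Polynomial.aeval S p ^ k) v = Complex.log l ^ k • v := by
      intro k
      rw [← map_pow, Module.End.aeval_apply_of_hasEigenvector hev, Polynomial.eval_pow, hp]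
    have := (NormedSpace.exp_series_hasSum_exp' (𝕂 := ℂ) (Complex.log l)).mul_right (f v)
    rw [← Complex.exp_eq_exp_ℂ, Complex.exp_log hl] at this
    simpa [hpow, hev.apply_eq_smul, mul_assoc] using this

/-- An invertible endomorphism in the centroid does not change the rank of an element `z` with
`z ∈ [𝔨, z]`. -/
theorem finrank_range_of_mem_lieCentroid [FiniteDimensional ℂ 𝔨] {A : Module.End ℂ 𝔨}
    (hA : A ∈ lieCentroid 𝔨) (hu : IsUnit A) {h z : 𝔨} (hz : ⁅h, z⁆ = z) :
    Module.finrank ℂ (LinearMap.range (ρ (A z))) = Module.finrank ℂ (LinearMap.range (ρ z)) := by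
  -- Jordan–Chevalley decomposition. Both parts are polynomials in `A`, hence lie in the centroid;
  -- `A` then factors as `s (1 + s⁻¹ n)`, a semisimple exponential times a unipotent.
  obtain ⟨n, hn, s, hs, hnil, hss, rfl⟩ := A.exists_isNilpotent_isSemisimple
  have hle : Algebra.adjoin ℂ {n + s} ≤ lieCentroid 𝔨 :=
    Algebra.adjoin_le (by simpa using hA)
  have hcomm : Commute n s := by
    have h1 : Commute (n + s) s := Algebra.commute_of_mem_adjoin_self hs
    simpa using h1.sub_left (Commute.refl s)
  have hsu : IsUnit s := by
    have := hnil.neg.isUnit_add_left_of_commute hu (((Commute.refl n).add_right hcomm).neg_left)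
    simpa using this
  obtain ⟨C, hC, hE⟩ := exists_isExp_of_isSemisimple hss hsu
  have hCZ : C ∈ lieCentroid 𝔨 :=
    (Algebra.adjoin_le (S := lieCentroid 𝔨) (by simpa using hle hs)) hC
  obtain ⟨u, rfl⟩ := hsu
  have hinv : (↑u⁻¹ : Module.End ℂ 𝔨) ∈ lieCentroid 𝔨 := by
    rw [lieCentroid, Subalgebra.mem_centralizer_iff]
    intro g hg
    have := (Subalgebra.mem_centralizer_iff ℂ).1 (hle hs) g hg
    exact Commute.units_inv_right (this : Commute g u)
  have hN := mul_mem hinv (hle hn)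
  obtain ⟨m, hm⟩ := hnil
  have hm' : ((↑u⁻¹ : Module.End ℂ 𝔨) * n) ^ (m + 1) = 0 := by
    rw [(Commute.units_inv_left hcomm.symm).mul_pow, pow_succ n, hm, zero_mul, mul_zero]
  have e : n + ↑u = (u : Module.End ℂ 𝔨) * (1 + ↑u⁻¹ * n) := by
    rw [mul_add, mul_one, Units.mul_inv_cancel_left, add_comm]
  have hw : ⁅h, (1 + ↑u⁻¹ * n : Module.End ℂ 𝔨) z⁆ = (1 + ↑u⁻¹ * n : Module.End ℂ 𝔨) z := by
    rw [← mem_lieCentroid.1 (add_mem (one_mem _) hN), hz]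
  rw [e, Module.End.mul_apply, finrank_range_of_isExp ρ hCZ hE hw,
    finrank_range_of_unipotent ρ m hN hm' hz]

end Representation

/-! ### The rank of the bracket form -/

/-- The matrix is the transpose of the matrix of `T` times the invertible Gram matrix of `ψ`. -/
theorem LinearMap.BilinForm.rank_of_comp {V ι : Type*} [AddCommGroup V] [Module ℂ V]
    [Fintype ι] (v : Module.Basis ι ℂ V) {ψ : LinearMap.BilinForm ℂ V} (hψ : ψ.Nondegenerate)
    (T : Module.End ℂ V) :
    (Matrix.of fun i j => ψ (T (v i)) (v j)).rank = Module.finrank ℂ (LinearMap.range T) := by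
  classical
  have h1 : (Matrix.of fun i j => ψ (T (v i)) (v j)) =
      (LinearMap.toMatrix v v T).transpose * LinearMap.BilinForm.toMatrix v ψ := by
    rw [← LinearMap.BilinForm.toMatrix_compLeft]
    ext i j
    simp [LinearMap.BilinForm.toMatrix_apply]
  have h2 := (LinearMap.BilinForm.nondegenerate_iff_det_ne_zero v).1 hψ
  rw [h1, Matrix.rank_mul_eq_left_of_isUnit_det _ _ h2.isUnit, Matrix.rank_transpose,
    LinearMap.finrank_range_eq_rank_toMatrix v]

theorem LinearMap.BilinForm.Nondegenerate.tensor {V₁ V₂ : Type*} [AddCommGroup V₁] [Module ℂ V₁]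
    [FiniteDimensional ℂ V₁] [AddCommGroup V₂] [Module ℂ V₂] [FiniteDimensional ℂ V₂]
    {ψ₁ : LinearMap.BilinForm ℂ V₁} {ψ₂ : LinearMap.BilinForm ℂ V₂} (h₁ : ψ₁.Nondegenerate)
    (h₂ : ψ₂.Nondegenerate) : (LinearMap.BilinForm.tmul ψ₁ ψ₂).Nondegenerate := by
  set b := Module.finBasis ℂ V₁
  set c := Module.finBasis ℂ V₂
  refine (LinearMap.BilinForm.nondegenerate_iff_det_ne_zero (b.tensorProduct c)).2 ?_
  have : LinearMap.BilinForm.toMatrix (b.tensorProduct c) (LinearMap.BilinForm.tmul ψ₁ ψ₂) =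
      Matrix.kroneckerMap (· * ·) (LinearMap.BilinForm.toMatrix b ψ₁)
        (LinearMap.BilinForm.toMatrix c ψ₂) := by
    ext i j
    rw [LinearMap.BilinForm.toMatrix_apply, Module.Basis.tensorProduct_apply',
      Module.Basis.tensorProduct_apply', LinearMap.BilinForm.tmul,
      LinearMap.BilinForm.tensorDistrib_tmul]
    simp [LinearMap.BilinForm.toMatrix_apply, mul_comm]
  rw [this, Matrix.det_kronecker]
  exact mul_ne_zero (pow_ne_zero _ ((LinearMap.BilinForm.nondegenerate_iff_det_ne_zero b).1 h₁))
    (pow_ne_zero _ ((LinearMap.BilinForm.nondegenerate_iff_det_ne_zero c).1 h₂))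

/-! ### Invariant forms and the centroid -/

section Centroid

variable {𝔨 : Type*} [LieRing 𝔨] [LieAlgebra ℂ 𝔨]

/-- `A` commutes with `ad n` and hence with its exponential. This carries the comparison of `z` with
`A z` along the whole orbit. -/
theorem lieCentroid_apply_of_mem_adjointGroup {A : Module.End ℂ 𝔨} (hA : A ∈ lieCentroid 𝔨)
    {e : 𝔨 ≃ₗ[ℂ] 𝔨} (he : e ∈ adjointGroup 𝔨) (z : 𝔨) : A (e z) = e (A z) := by
  induction he using Subgroup.closure_induction generalizing z with
  | mem e he =>
    obtain ⟨n, N, -, hn⟩ := he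
    have : ∀ k, A (((LieAlgebra.ad ℂ 𝔨 n) ^ k) z) = ((LieAlgebra.ad ℂ 𝔨 n) ^ k) (A z) := by
      intro k
      induction k with
      | zero => rfl
      | succ k ih =>
        rw [pow_succ', Module.End.mul_apply, Module.End.mul_apply, LieAlgebra.ad_apply,
          LieAlgebra.ad_apply, mem_lieCentroid.1 hA, ih]
    simp [hn, this]
  | one => rfl
  | mul a b _ _ iha ihb => exact (iha _).trans (congrArg a (ihb _))
  | inv a _ ih =>
    have := ih (a⁻¹ z)
    rw [show a (a⁻¹ z) = z from a.apply_symm_apply z] at this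
    rw [this]
    exact (a.symm_apply_apply _).symm

variable [FiniteDimensional ℂ 𝔨]

/-- Two invariant nondegenerate forms differ by an invertible element of the centroid. -/
theorem exists_mem_lieCentroid {Φ τ : LinearMap.BilinForm ℂ 𝔨} (hΦ : Φ.lieInvariant 𝔨)
    (hΦ' : Φ.Nondegenerate) (hτ : τ.lieInvariant 𝔨) (hτ' : τ.Nondegenerate) :
    ∃ A ∈ lieCentroid 𝔨, IsUnit A ∧ ∀ z w, Φ z w = τ (A z) w := by
  set A := LinearMap.BilinForm.symmCompOfNondegenerate Φ τ hτ'
  have hA : ∀ z w, Φ z w = τ (A z) w := fun z w =>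
    (LinearMap.congr_fun (LinearMap.BilinForm.comp_symmCompOfNondegenerate_apply Φ hτ' z) w).symm
  refine ⟨A, mem_lieCentroid.2 fun x y => ?_, ?_, hA⟩
  · rw [← sub_eq_zero]
    refine hτ'.1 _ fun w => ?_
    rw [map_sub, LinearMap.sub_apply, ← hA, hΦ, hτ, hA, sub_self]
  · rw [LinearMap.isUnit_iff_ker_eq_bot, LinearMap.ker_eq_bot']
    intro z hz
    exact hΦ'.1 z fun w => by rw [hA, hz, map_zero, LinearMap.zero_apply]

/-- If `z` is orthogonal to its centralizer, then `z ∈ [𝔨, z]`. -/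
theorem exists_lie_eq_self {τ : LinearMap.BilinForm ℂ 𝔨} (hτ : τ.lieInvariant 𝔨)
    (hτ' : τ.Nondegenerate) {z : 𝔨} (hz : ∀ c : 𝔨, ⁅z, c⁆ = 0 → τ c z = 0) : ∃ h : 𝔨, ⁅h, z⁆ = z := by
  by_contra H
  have hmem : z ∉ LinearMap.range (LieAlgebra.ad ℂ 𝔨 z) := by
    rintro ⟨h, hh⟩
    exact H ⟨-h, by rw [neg_lie, lie_skew]; exact hh⟩
  -- A functional that kills `[z, 𝔨]` but not `z` is `τ(c, ·)` for some `c`. By invariance `c`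
  -- centralizes `z`, so `τ(c, z) = 0`, a contradiction.
  obtain ⟨f, hf, hf'⟩ := Submodule.exists_dual_map_eq_bot_of_notMem hmem inferInstance
  obtain ⟨c, rfl⟩ := (τ.toDual hτ').surjective f
  refine hf (hz c (hτ'.1 _ fun w => ?_))
  have : (τ.toDual hτ' c) ⁅z, w⁆ = 0 := by
    have h1 : (τ.toDual hτ' c) ⁅z, w⁆ ∈
        (LinearMap.range (LieAlgebra.ad ℂ 𝔨 z)).map (τ.toDual hτ' c) :=
      ⟨_, ⟨w, rfl⟩, rfl⟩
    rw [hf'] at h1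
    exact h1
  rw [LinearMap.BilinForm.toDual_def] at this
  rw [hτ, this, neg_zero]

end Centroid

/-- The orthogonal sum of two bilinear forms. -/
noncomputable def prodForm {𝔨₁ 𝔨₂ : Type*} [LieRing 𝔨₁] [LieAlgebra ℂ 𝔨₁] [LieRing 𝔨₂]
    [LieAlgebra ℂ 𝔨₂] (τ₁ : LinearMap.BilinForm ℂ 𝔨₁) (τ₂ : LinearMap.BilinForm ℂ 𝔨₂) :
    LinearMap.BilinForm ℂ (𝔨₁ × 𝔨₂) :=
  τ₁.compl₁₂ (LinearMap.fst ℂ 𝔨₁ 𝔨₂) (LinearMap.fst ℂ 𝔨₁ 𝔨₂) +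
    τ₂.compl₁₂ (LinearMap.snd ℂ 𝔨₁ 𝔨₂) (LinearMap.snd ℂ 𝔨₁ 𝔨₂)

theorem prodForm_apply {𝔨₁ 𝔨₂ : Type*} [LieRing 𝔨₁] [LieAlgebra ℂ 𝔨₁] [LieRing 𝔨₂]
    [LieAlgebra ℂ 𝔨₂] (τ₁ : LinearMap.BilinForm ℂ 𝔨₁) (τ₂ : LinearMap.BilinForm ℂ 𝔨₂)
    (z w : 𝔨₁ × 𝔨₂) : prodForm τ₁ τ₂ z w = τ₁ z.1 w.1 + τ₂ z.2 w.2 := rfl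

/-! ### The bracket form and the action on the odd part -/

section SuperData

variable {𝔨₁ 𝔨₂ V₁ V₂ : Type*} [LieRing 𝔨₁] [LieAlgebra ℂ 𝔨₁] [FiniteDimensional ℂ 𝔨₁]
  [LieRing 𝔨₂] [LieAlgebra ℂ 𝔨₂] [FiniteDimensional ℂ 𝔨₂]
  [AddCommGroup V₁] [Module ℂ V₁] [FiniteDimensional ℂ V₁]
  [AddCommGroup V₂] [Module ℂ V₂] [FiniteDimensional ℂ V₂]

/-- An invariant form `τ` on `𝔨` for which the map `π : V × V → 𝔨` is dual to the action of `𝔨` on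
`V`, the module `V` being identified with its dual by `ψ`. -/
structure IsMomentForm {𝔨 V : Type*} [LieRing 𝔨] [LieAlgebra ℂ 𝔨] [AddCommGroup V] [Module ℂ V]
    (ρ : 𝔨 →ₗ⁅ℂ⁆ Module.End ℂ V) (ψ : LinearMap.BilinForm ℂ V) (π : V →ₗ[ℂ] V →ₗ[ℂ] 𝔨)
    (τ : LinearMap.BilinForm ℂ 𝔨) : Prop where
  invariant : τ.lieInvariant 𝔨
  faithful : ∀ x, ρ x = 0 → x = 0
  apply_pair : ∀ x u v, τ x (π u v) = ψ (ρ x u) v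
  orthogonal : ∀ x c : 𝔨, IsNilpotent (ρ x) → ⁅x, c⁆ = 0 → τ c x = 0

theorem LieSuperData.prime_and_formRank (D : LieSuperData 𝔨₁ 𝔨₂ V₁ V₂)
    {τ₁ : LinearMap.BilinForm ℂ 𝔨₁} {τ₂ : LinearMap.BilinForm ℂ 𝔨₂}
    (h₁ : IsMomentForm D.ρ₁ D.ψ₁ D.π₁ τ₁) (h₂ : IsMomentForm D.ρ₂ D.ψ₂ D.π₂ τ₂)
    (hψ₁ : D.ψ₁.Nondegenerate) (hψ₂ : D.ψ₂.Nondegenerate)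
    {Φ : LinearMap.BilinForm ℂ (𝔨₁ × 𝔨₂)} (hΦ : Φ.lieInvariant (𝔨₁ × 𝔨₂)) (hΦ' : Φ.Nondegenerate)
    {x : 𝔨₁} {y : 𝔨₂} (hx : IsNilpotent (D.ρ₁ x)) (hy : IsNilpotent (D.ρ₂ y))
    {ι : Type*} [Fintype ι] (v : Module.Basis ι ℂ (V₁ ⊗[ℂ] V₂)) :
    (idealOfSet Φ (adjointOrbit (x, y))).IsPrime ∧
      D.toLieSuperalgebra.formRank v (idealOfSet Φ (adjointOrbit (x, y))) =
        Module.finrank ℂ (LinearMap.range (D.tensorAction (x, y))) := by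
  have hprime := isPrime_idealOfSet_adjointOrbit Φ (x, y)
  refine ⟨hprime, ?_⟩
  set τ := prodForm τ₁ τ₂
  set ψ := LinearMap.BilinForm.tmul D.ψ₁ D.ψ₂
  have hτ : τ.lieInvariant (𝔨₁ × 𝔨₂) := by
    intro a b c
    simp only [τ, prodForm_apply, LieAlgebra.Prod.bracket_apply, h₁.invariant a.1, h₂.invariant a.2]
    ring
  have hψ : ψ.Nondegenerate := hψ₁.tensor hψ₂
  have hpair : ∀ z a b, τ z (D.oddBracket a b) = ψ (D.tensorAction z a) b := by
    intro z a b
    induction a with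
    | zero => simp
    | add a a' h h' => simp only [map_add, LinearMap.add_apply, h, h']
    | tmul u₁ u₂ =>
      induction b with
      | zero => simp
      | add b b' h h' => simp only [map_add, h, h']
      | tmul v₁ v₂ =>
        simp [τ, ψ, prodForm_apply, h₁.apply_pair, h₂.apply_pair]
        ring
  -- If `z` is orthogonal to all `π₁ u w` and `π₂ u w`, then by duality both its components act as
  -- zero, and the two representations are faithful.
  have hτ' : τ.Nondegenerate := by
    refine LinearMap.BilinForm.Nondegenerate.ofSeparatingLeft fun z hz => ?_
    have e1 : D.ρ₁ z.1 = 0 := LinearMap.ext fun u => hψ₁.1 _ fun w => by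
      rw [← h₁.apply_pair]
      simpa [τ, prodForm_apply] using hz (D.π₁ u w, 0)
    have e2 : D.ρ₂ z.2 = 0 := LinearMap.ext fun u => hψ₂.1 _ fun w => by
      rw [← h₂.apply_pair]
      simpa [τ, prodForm_apply] using hz (0, D.π₂ u w)
    exact Prod.ext (h₁.faithful _ e1) (h₂.faithful _ e2)
  obtain ⟨h, hh⟩ : ∃ h : 𝔨₁ × 𝔨₂, ⁅h, (x, y)⁆ = (x, y) := by
    refine exists_lie_eq_self hτ hτ' fun c hc => ?_
    rw [LieAlgebra.Prod.bracket_apply, Prod.mk_eq_zero] at hc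
    simp only [τ, prodForm_apply]
    rw [h₁.orthogonal x c.1 hx hc.1, h₂.orthogonal y c.2 hy hc.2, add_zero]
  obtain ⟨A, hA, hAu, hAΦ⟩ := exists_mem_lieCentroid hΦ hΦ' hτ hτ'
  -- At `e (x, y)` the matrix is the Gram matrix of `ψ` twisted by the action of `A (e (x, y)) = e
  -- (A (x, y))`. Removing first `e` and then `A` leaves the rank unchanged.
  have hrank : ∀ z : adjointOrbit (x, y), ((D.toLieSuperalgebra.bracketMatrix v).map
      (evalAt Φ z.1)).rank = Module.finrank ℂ (LinearMap.range (D.tensorAction (x, y))) := by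
    rintro ⟨_, e, he, rfl⟩
    have : ((D.toLieSuperalgebra.bracketMatrix v).map (evalAt Φ (e (x, y)))) =
        Matrix.of fun i j => ψ (D.tensorAction (A (e (x, y))) (v i)) (v j) := by
      ext i j
      simp only [LieSuperalgebra.bracketMatrix, Matrix.map_apply, Matrix.of_apply, evalAt,
        SymmetricAlgebra.lift_ι_apply, hAΦ, ← hpair]
      rfl
    rw [this, LinearMap.BilinForm.rank_of_comp v hψ, lieCentroid_apply_of_mem_adjointGroup hA he,
      finrank_range_of_mem_adjointGroup _ he, finrank_range_of_mem_lieCentroid _ hA hAu hh]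
  have key := rank_map_fractionRing_quotient (idealOfSet Φ (adjointOrbit (x, y)))
    (fun z : adjointOrbit (x, y) => evalAt Φ z.1)
    (fun f => by rw [mem_idealOfSet, Subtype.forall])
    (D.toLieSuperalgebra.bracketMatrix v) ⟨(x, y), 1, one_mem _, rfl⟩
    (fun z => by rw [hrank, hrank])
  rw [LieSuperalgebra.formRank, key, hrank]

end SuperData

/-! ### The kernel of a sum of two Jordan matrices -/

section Jordan

variable {V : Type*} [AddCommGroup V] [Module ℂ V] {r : ℕ} {s : Fin r → ℕ}

/-- The coordinate at position `a` of the block `i`; it is zero if `a` is out of range. -/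
noncomputable def blockCoord (b : Module.Basis (Σ i, Fin (s i)) ℂ V) (i : Fin r) (a : ℕ) :
    V →ₗ[ℂ] ℂ :=
  if h : a < s i then b.coord ⟨i, ⟨a, h⟩⟩ else 0

theorem blockCoord_of_lt (b : Module.Basis (Σ i, Fin (s i)) ℂ V) {i : Fin r} {a : ℕ}
    (h : a < s i) : blockCoord b i a = b.coord ⟨i, ⟨a, h⟩⟩ := dif_pos h

theorem blockCoord_of_le (b : Module.Basis (Σ i, Fin (s i)) ℂ V) {i : Fin r} {a : ℕ}
    (h : s i ≤ a) : blockCoord b i a = 0 := dif_neg h.not_gt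

theorem blockCoord_basis (b : Module.Basis (Σ i, Fin (s i)) ℂ V) (i k : Fin r) (a : ℕ)
    (c : Fin (s k)) : blockCoord b i a (b ⟨k, c⟩) = if i = k ∧ a = c then 1 else 0 := by
  classical
  by_cases h : a < s i
  · rw [blockCoord_of_lt b h, Module.Basis.coord_apply, Module.Basis.repr_self,
      Finsupp.single_apply]
    congr 1
    rw [eq_iff_iff, Sigma.mk.injEq]
    constructor
    · rintro ⟨rfl, h⟩
      exact ⟨rfl, by rw [eq_of_heq h]⟩
    · rintro ⟨rfl, h⟩
      exact ⟨rfl, heq_of_eq (Fin.ext h.symm)⟩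
  · rw [blockCoord_of_le b (not_lt.1 h), if_neg]
    · rfl
    · rintro ⟨rfl, rfl⟩
      exact h c.2

/-- The default value zero beyond the end of a block makes the shift rule hold for all `a`, with no
boundary case. -/
theorem blockCoord_comp {b : Module.Basis (Σ i, Fin (s i)) ℂ V} {T : Module.End ℂ V}
    (h0 : ∀ (i : Fin r) (h : 0 < s i), T (b ⟨i, ⟨0, h⟩⟩) = 0)
    (h1 : ∀ (i : Fin r) (j : ℕ) (h : j + 1 < s i),
      T (b ⟨i, ⟨j + 1, h⟩⟩) = b ⟨i, ⟨j, Nat.lt_of_succ_lt h⟩⟩) (i : Fin r) (a : ℕ) :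
    blockCoord b i a ∘ₗ T = blockCoord b i (a + 1) := by
  refine b.ext ?_
  rintro ⟨k, ⟨_ | c, hc⟩⟩
  · rw [LinearMap.comp_apply, h0, map_zero, blockCoord_basis, if_neg (by simp)]
  · rw [LinearMap.comp_apply, h1, blockCoord_basis, blockCoord_basis]
    simp

theorem HasJordanType.isNilpotent {T : Module.End ℂ V} {m : ℕ} {μ : m.Partition}
    (h : HasJordanType T μ) : IsNilpotent T := by
  obtain ⟨r, s, b, -, h0, h1⟩ := h
  have hpow : ∀ k i a, blockCoord b i a ∘ₗ (T ^ k) = blockCoord b i (a + k) := by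
    intro k
    induction k with
    | zero => intro i a; rfl
    | succ k ih =>
      intro i a
      rw [pow_succ', Module.End.mul_eq_comp, ← LinearMap.comp_assoc, blockCoord_comp h0 h1, ih]
      congr 1
      ring
  -- The exponent is at least every block size, so the shift moves each coordinate out of range.
  refine ⟨∑ i, s i, LinearMap.ext fun v => b.ext_elem fun ⟨i, a⟩ => ?_⟩
  have := LinearMap.congr_fun (hpow (∑ i, s i) i a) v
  rw [blockCoord_of_le b (le_add_left (Finset.single_le_sum (fun _ _ => Nat.zero_le _)
    (Finset.mem_univ i))), blockCoord_of_lt b a.2] at this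
  simpa using this

variable {V' : Type*} [AddCommGroup V'] [Module ℂ V'] {r' : ℕ} {t : Fin r' → ℕ}

/-- The coordinates of `V ⊗ V'` with respect to the tensor product of two block bases. -/
noncomputable def blockCoordTensor (b : Module.Basis (Σ i, Fin (s i)) ℂ V)
    (c : Module.Basis (Σ i, Fin (t i)) ℂ V') (i : Fin r) (a : ℕ) (j : Fin r') (e : ℕ) :
    V ⊗[ℂ] V' →ₗ[ℂ] ℂ :=
  (TensorProduct.lid ℂ ℂ).toLinearMap ∘ₗ TensorProduct.map (blockCoord b i a) (blockCoord c j e)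

theorem blockCoordTensor_tmul (b : Module.Basis (Σ i, Fin (s i)) ℂ V)
    (c : Module.Basis (Σ i, Fin (t i)) ℂ V') (i : Fin r) (a : ℕ) (j : Fin r') (e : ℕ) (u : V)
    (v : V') : blockCoordTensor b c i a j e (u ⊗ₜ v) = blockCoord b i a u * blockCoord c j e v :=
  rfl

theorem blockCoordTensor_eq_repr (b : Module.Basis (Σ i, Fin (s i)) ℂ V)
    (c : Module.Basis (Σ i, Fin (t i)) ℂ V') (i : Fin r) (a : Fin (s i)) (j : Fin r')
    (e : Fin (t j)) (w : V ⊗[ℂ] V') :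
    blockCoordTensor b c i a j e w = (b.tensorProduct c).repr w (⟨i, a⟩, ⟨j, e⟩) := by
  induction w with
  | zero => simp
  | add w w' h h' => simp [h, h']
  | tmul u v =>
    rw [blockCoordTensor_tmul, blockCoord_of_lt b a.2, blockCoord_of_lt c e.2]
    simp [mul_comm]

/-- For each pair of blocks the kernel equations on coordinates are `F(a + 1, e) = -F(a, e + 1)`. A
solution alternates in sign along each antidiagonal `a + e = k`, so it is determined by its row `a =
0`. An antidiagonal with `k ≥ min s t` runs out of range and carries only zeros; the others are
free. -/
theorem finrank_ker_tensor {T : Module.End ℂ V} {T' : Module.End ℂ V'}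
    (b : Module.Basis (Σ i, Fin (s i)) ℂ V) (c : Module.Basis (Σ i, Fin (t i)) ℂ V')
    (h0 : ∀ (i : Fin r) (h : 0 < s i), T (b ⟨i, ⟨0, h⟩⟩) = 0)
    (h1 : ∀ (i : Fin r) (j : ℕ) (h : j + 1 < s i),
      T (b ⟨i, ⟨j + 1, h⟩⟩) = b ⟨i, ⟨j, Nat.lt_of_succ_lt h⟩⟩)
    (h0' : ∀ (i : Fin r') (h : 0 < t i), T' (c ⟨i, ⟨0, h⟩⟩) = 0)
    (h1' : ∀ (i : Fin r') (j : ℕ) (h : j + 1 < t i),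
      T' (c ⟨i, ⟨j + 1, h⟩⟩) = c ⟨i, ⟨j, Nat.lt_of_succ_lt h⟩⟩) :
    Module.finrank ℂ (LinearMap.ker (TensorProduct.map T (LinearMap.id : Module.End ℂ V') +
      TensorProduct.map (LinearMap.id : Module.End ℂ V) T')) = ∑ i, ∑ j, min (s i) (t j) := by
  set F := blockCoordTensor b c
  set R := TensorProduct.map T (LinearMap.id : Module.End ℂ V') +
    TensorProduct.map (LinearMap.id : Module.End ℂ V) T'
  have hF : ∀ i a j e w, F i a j e (R w) = F i (a + 1) j e w + F i a j (e + 1) w := by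
    intro i a j e w
    induction w with
    | zero => simp
    | add w w' h h' => simp only [map_add, h, h']; ring
    | tmul u v =>
      have e1 := LinearMap.congr_fun (blockCoord_comp h0 h1 i a) u
      have e2 := LinearMap.congr_fun (blockCoord_comp h0' h1' j e) v
      rw [LinearMap.comp_apply] at e1 e2
      simp [R, F, blockCoordTensor_tmul, e1, e2]
  have hF0 : ∀ i a j e w, s i ≤ a ∨ t j ≤ e → F i a j e w = 0 := by
    intro i a j e w h
    simp only [F, blockCoordTensor]
    rcases h with h | h
    · rw [blockCoord_of_le b h]; simp
    · rw [blockCoord_of_le c h]; simp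
  have hext : ∀ w w', (∀ i a j e, F i a j e w = F i a j e w') → w = w' := by
    intro w w' h
    refine (b.tensorProduct c).ext_elem ?_
    rintro ⟨⟨i, a⟩, ⟨j, e⟩⟩
    rw [← blockCoordTensor_eq_repr, ← blockCoordTensor_eq_repr]
    exact h i a j e
  set I := Σ p : Fin r × Fin r', Fin (min (s p.1) (t p.2))
  let L : LinearMap.ker R →ₗ[ℂ] (I → ℂ) :=
    (LinearMap.pi fun q : I => F q.1.1 0 q.1.2 q.2) ∘ₗ (LinearMap.ker R).subtype
  have hL : ∀ w q, L w q = F q.1.1 0 q.1.2 q.2 w := fun _ _ => rfl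
  have hinj : Function.Injective L := by
    rw [injective_iff_map_eq_zero]
    intro w hw
    have hker : ∀ i a j e, F i (a + 1) j e w = -F i a j (e + 1) w := by
      intro i a j e
      have := hF i a j e w
      rw [show R w = 0 from w.2, map_zero] at this
      exact eq_neg_of_add_eq_zero_left this.symm
    have hsign : ∀ a i j e, F i a j e w = (-1) ^ a * F i 0 j (a + e) w := by
      intro a
      induction a with
      | zero => intro i j e; simp
      | succ a ih =>
        intro i j e
        rw [hker, ih, show a + 1 + e = a + (e + 1) by ring]
        ring
    have hzero : ∀ i j k, F i 0 j k w = 0 := by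
      intro i j k
      by_cases hk : k < min (s i) (t j)
      · exact congrFun hw ⟨(i, j), ⟨k, hk⟩⟩
      · rw [lt_min_iff, not_and_or, not_lt, not_lt] at hk
        rcases hk with hk | hk
        · have := hsign k i j 0
          rw [hF0 _ _ _ _ _ (Or.inl hk), add_zero, eq_comm, mul_eq_zero] at this
          exact this.resolve_left (pow_ne_zero _ (by norm_num))
        · exact hF0 _ _ _ _ _ (Or.inr hk)
    refine Subtype.ext (hext _ _ fun i a j e => ?_)
    rw [hsign, hzero]
    simp
  have hsurj : Function.Surjective L := by
    intro f
    -- The alternating solution with the prescribed row `a = 0`, cut off at `a + e = min (s i) (t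
    -- j)`; the cutoff also makes it vanish out of range.
    let g : Fin r → ℕ → Fin r' → ℕ → ℂ := fun i a j e =>
      if h : a + e < min (s i) (t j) then (-1) ^ a * f ⟨(i, j), ⟨a + e, h⟩⟩ else 0
    set w := (b.tensorProduct c).equivFun.symm fun q => g q.1.1 q.1.2 q.2.1 q.2.2
    have hw : ∀ i a j e, F i a j e w = g i a j e := by
      intro i a j e
      by_cases h : a < s i ∧ e < t j
      · have := blockCoordTensor_eq_repr b c i ⟨a, h.1⟩ j ⟨e, h.2⟩ w
        rw [this, ← Module.Basis.equivFun_apply, LinearEquiv.apply_symm_apply]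
      · rw [not_and_or, not_lt, not_lt] at h
        rw [hF0 _ _ _ _ _ h, eq_comm]
        exact dif_neg (by lia)
    have hwR : R w = 0 := by
      refine hext _ _ fun i a j e => ?_
      rw [hF, hw, hw, map_zero]
      simp only [g]
      by_cases h : a + (e + 1) < min (s i) (t j)
      · have h' : a + 1 + e < min (s i) (t j) := by lia
        rw [dif_pos h, dif_pos h']
        have : (⟨a + 1 + e, h'⟩ : Fin (min (s i) (t j))) = ⟨a + (e + 1), h⟩ := Fin.ext (by lia)
        rw [this]
        ring
      · rw [dif_neg h, dif_neg (by lia), add_zero]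
    refine ⟨⟨w, hwR⟩, funext fun q => ?_⟩
    rw [hL, hw]
    have : 0 + (q.2 : ℕ) < min (s q.1.1) (t q.1.2) := by rw [zero_add]; exact q.2.2
    simp only [g, dif_pos this, pow_zero, one_mul]
    congr 1
    obtain ⟨p, k⟩ := q
    simp
  rw [(LinearEquiv.ofBijective L ⟨hinj, hsurj⟩).finrank_eq, Module.finrank_fintype_fun_eq_card,
    Fintype.card_sigma, Fintype.sum_prod_type]
  simp

theorem Nat.Partition.dualPart_eq_card {m : ℕ} {μ : m.Partition}
    (h : Finset.univ.val.map s = μ.parts) (k : ℕ) :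
    μ.dualPart k = (Finset.univ.filter fun i => k ≤ s i).card := by
  rw [Nat.Partition.dualPart, ← h, Multiset.filter_map, Multiset.card_map]
  rfl

/-- Write `min a b` as the number of `k ≥ 1` with `k ≤ a` and `k ≤ b`, then sum over the blocks
first. Stopping at `m` loses nothing, since no part of `μ` exceeds `m`. -/
theorem sum_min_eq_sum_dualPart {m n : ℕ} {μ : m.Partition} {ν : n.Partition}
    (hs : Finset.univ.val.map s = μ.parts) (ht : Finset.univ.val.map t = ν.parts) :
    ∑ i, ∑ j, min (s i) (t j) = ∑ k ∈ Finset.Icc 1 m, μ.dualPart k * ν.dualPart k := by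
  have hle : ∀ i, s i ≤ m := by
    intro i
    rw [← μ.parts_sum]
    exact Multiset.le_sum_of_mem (hs ▸ Multiset.mem_map_of_mem s (Finset.mem_univ_val i))
  have hmin : ∀ i j, min (s i) (t j) =
      ∑ k ∈ Finset.Icc 1 m, (if k ≤ s i then 1 else 0) * (if k ≤ t j then 1 else 0) := by
    intro i j
    simp only [← ite_and, mul_ite, mul_one, mul_zero]
    rw [← Finset.card_filter]
    have : (Finset.Icc 1 m).filter (fun k => k ≤ t j ∧ k ≤ s i) =
        Finset.Icc 1 (min (s i) (t j)) := by
      ext k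
      have := hle i
      simp only [Finset.mem_filter, Finset.mem_Icc]
      lia
    rw [this, Nat.card_Icc, Nat.add_sub_cancel]
  simp only [hmin, Nat.Partition.dualPart_eq_card hs, Nat.Partition.dualPart_eq_card ht,
    Finset.card_filter, Finset.sum_mul_sum]
  rw [Finset.sum_congr rfl fun i _ => Finset.sum_comm, Finset.sum_comm]

theorem finrank_range_tensor [FiniteDimensional ℂ V] [FiniteDimensional ℂ V']
    {T : Module.End ℂ V} {T' : Module.End ℂ V'} {m n : ℕ} {μ : m.Partition} {ν : n.Partition}
    (hT : HasJordanType T μ) (hT' : HasJordanType T' ν) :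
    (Module.finrank ℂ (LinearMap.range (TensorProduct.map T (LinearMap.id : Module.End ℂ V') +
      TensorProduct.map (LinearMap.id : Module.End ℂ V) T')) : ℤ) =
      Module.finrank ℂ (V ⊗[ℂ] V') -
        ∑ i ∈ Finset.Icc 1 m, (μ.dualPart i * ν.dualPart i : ℤ) := by
  obtain ⟨r, s, b, hs, h0, h1⟩ := hT
  obtain ⟨r', t, c, ht, h0', h1'⟩ := hT'
  have h2 := finrank_ker_tensor b c h0 h1 h0' h1'
  rw [sum_min_eq_sum_dualPart hs ht] at h2
  have h3 := LinearMap.finrank_range_add_finrank_ker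
    (TensorProduct.map T (LinearMap.id : Module.End ℂ V') +
      TensorProduct.map (LinearMap.id : Module.End ℂ V) T')
  rw [h2] at h3
  rw [← h3]
  push_cast
  ring

end Jordan

/-! ### Moment forms given by traces -/

/-- The form `(x, y) ↦ a tr (ρ x ∘ ρ y)`. -/
noncomputable def repTraceForm {𝔨 W : Type*} [LieRing 𝔨] [LieAlgebra ℂ 𝔨] [AddCommGroup W]
    [Module ℂ W] (a : ℂ) (ρ : 𝔨 →ₗ⁅ℂ⁆ Module.End ℂ W) : LinearMap.BilinForm ℂ 𝔨 :=
  a • ((LinearMap.mul ℂ (Module.End ℂ W)).compr₂ (LinearMap.trace ℂ W)).compl₁₂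
    ρ.toLinearMap ρ.toLinearMap

theorem repTraceForm_apply {𝔨 W : Type*} [LieRing 𝔨] [LieAlgebra ℂ 𝔨] [AddCommGroup W]
    [Module ℂ W] (a : ℂ) (ρ : 𝔨 →ₗ⁅ℂ⁆ Module.End ℂ W) (x y : 𝔨) :
    repTraceForm a ρ x y = a * LinearMap.trace ℂ W (ρ x * ρ y) := rfl

/-- Invariance is cyclicity of the trace. For orthogonality, the product of a nilpotent with a
commuting operator is nilpotent, hence traceless. The trace may be taken on a module `W` other than
`V`; for `F(4)` this is `ℂ⁷` in place of the spin module. -/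
theorem isMomentForm_repTraceForm {𝔨 V W : Type*} [LieRing 𝔨] [LieAlgebra ℂ 𝔨] [AddCommGroup V]
    [Module ℂ V] [AddCommGroup W] [Module ℂ W] [FiniteDimensional ℂ W]
    {ρ : 𝔨 →ₗ⁅ℂ⁆ Module.End ℂ V} {ψ : LinearMap.BilinForm ℂ V} {π : V →ₗ[ℂ] V →ₗ[ℂ] 𝔨}
    (σ : 𝔨 →ₗ⁅ℂ⁆ Module.End ℂ W) (a : ℂ) (hρ : ∀ x, ρ x = 0 → x = 0)
    (hσ : ∀ x, IsNilpotent (ρ x) → IsNilpotent (σ x))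
    (h : ∀ x u v, a * LinearMap.trace ℂ W (σ x * σ (π u v)) = ψ (ρ x u) v) :
    IsMomentForm ρ ψ π (repTraceForm a σ) where
  invariant x y z := by
    simp only [repTraceForm_apply, LieHom.map_lie, LieRing.of_associative_ring_bracket, sub_mul,
      mul_sub, map_sub]
    rw [mul_assoc (σ x), LinearMap.trace_mul_comm ℂ (σ x), mul_assoc (σ y), mul_assoc (σ y)]
    ring
  faithful := hρ
  apply_pair := h
  orthogonal x c hx hc := by
    have hcomm : Commute (σ c) (σ x) := by
      have := congrArg σ hc
      rw [LieHom.map_lie, map_zero, LieRing.of_associative_ring_bracket, sub_eq_zero] at this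
      exact this.symm
    have := LinearMap.isNilpotent_trace_of_isNilpotent (hcomm.isNilpotent_mul_left (hσ x hx))
    rw [repTraceForm_apply, this.eq_zero, mul_zero]

/-- `formMap ψ u v` is a difference of two operators of rank at most one, whose traces are
evaluations. -/
theorem trace_mul_formMap {V : Type*} [AddCommGroup V] [Module ℂ V] [FiniteDimensional ℂ V]
    (ψ : LinearMap.BilinForm ℂ V) (x : Module.End ℂ V) (u v : V) :
    LinearMap.trace ℂ V (x * formMap ψ u v) = ψ v (x u) - ψ (x v) u := by
  have : x * formMap ψ u v = (ψ v).smulRight (x u) - (ψ.flip u).smulRight (x v) := by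
    ext w
    simp
  rw [this, map_sub, LinearMap.trace_smulRight, LinearMap.trace_smulRight]
  rfl

/-- For skew-adjoint `x` the trace of `x ∘ formMap ψ u v` is `2 ψ(v, x u) = 2 ε ψ(x u, v)`, which
explains the factor `ε / 2`. -/
theorem isMomentForm_skewMap {V : Type*} [AddCommGroup V] [Module ℂ V] [FiniteDimensional ℂ V]
    {ψ : LinearMap.BilinForm ℂ V} {ε : ℂ} (hε : ε * ε = 1) (h : ∀ u v, ψ u v = ε * ψ v u) :
    IsMomentForm (skewAdjointLieSubalgebra ψ).incl ψ (skewMap hε h)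
      (repTraceForm (ε / 2) (skewAdjointLieSubalgebra ψ).incl) := by
  refine isMomentForm_repTraceForm _ _ (fun x hx => Subtype.ext hx) (fun x hx => hx) ?_
  intro x u v
  simp only [LieSubalgebra.coe_incl, coe_skewMap, trace_mul_formMap]
  have h1 := skewAdjoint_apply ψ x v u
  rw [h (x.1 u) v]
  linear_combination -(ε / 2) * h1

/-! ### The form for `G(3)` -/

theorem trace_eq_sum_dot7 (T : Module.End ℂ (Fin 7 → ℂ)) :
    LinearMap.trace ℂ (Fin 7 → ℂ) T =
      ∑ i, dot7 (T (Pi.single i 1)) (Pi.single i 1) := by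
  rw [LinearMap.trace_eq_matrix_trace ℂ (Pi.basisFun ℂ (Fin 7)), Matrix.trace]
  refine Finset.sum_congr rfl fun i _ => ?_
  simp [dot7_apply, Pi.single_apply]

/-- By skewness of `x`, each coordinate of the sum is twice a sum of three matrix entries of `x`,
and the derivation rule makes that sum vanish. -/
theorem sum_cross7_g2 (x : g2) :
    ∑ i, cross7 (Pi.single i 1) (x.1 (Pi.single i 1)) = 0 := by
  have hs : ∀ i j : Fin 7, x.1 (Pi.single i 1) j + x.1 (Pi.single j 1) i = 0 := by
    intro i j
    simpa [dot7_apply, Pi.single_apply] using g2_dot7 x (Pi.single i 1) (Pi.single j 1)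
  have hd : ∀ k : Fin 7, x.1 (Pi.single (k + 4) 1) (k + 5) + x.1 (Pi.single (k + 1) 1) (k + 3) +
      x.1 (Pi.single (k + 2) 1) (k + 6) = 0 := by
    intro k
    -- The derivation rule for `e (k + 1) × e (k + 2) = e (k + 4)`, read at coordinate `k + 5`, is
    -- the relation sought.
    have h := congrFun (g2_apply x (Pi.single (k + 1) 1) (Pi.single (k + 2) 1)) (k + 5)
    have e : cross7 (Pi.single (k + 1) 1) (Pi.single (k + 2) 1) = Pi.single (k + 4) 1 := by
      ext l
      fin_cases k <;> fin_cases l <;> simp [cross7_apply]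
    rw [e] at h
    rw [h]
    fin_cases k <;> simp [cross7_apply]
  ext k
  rw [Finset.sum_apply]
  have h0 := hd k
  have h1 := hs (k + 1) (k + 3)
  have h2 := hs (k + 2) (k + 6)
  have h3 := hs (k + 4) (k + 5)
  fin_cases k <;> simp [Fin.sum_univ_seven, cross7_apply, Pi.single_apply] at * <;>
    linear_combination 2 * h0 - h1 - h2 - h3

/-- The trace equals `-⟨w, ∑ e_i × x e_i⟩`. Thus `𝔤₂` is trace-orthogonal to the operators `w × ·`,
and the cross product term of `g2End` drops out of the moment form. -/
theorem trace_mul_cross7 (x : g2) (w : Fin 7 → ℂ) :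
    LinearMap.trace ℂ (Fin 7 → ℂ) (x.1 * cross7 w) = 0 := by
  have e : ∀ i : Fin 7, dot7 ((x.1 * cross7 w) (Pi.single i 1)) (Pi.single i 1) =
      -dot7 w (cross7 (Pi.single i 1) (x.1 (Pi.single i 1))) := by
    intro i
    rw [Module.End.mul_apply, ← dot7_cross7]
    exact eq_neg_of_add_eq_zero_left (g2_dot7 x _ _)
  rw [trace_eq_sum_dot7, Finset.sum_congr rfl fun i _ => e i, Finset.sum_neg_distrib, ← map_sum,
    sum_cross7_g2, map_zero, neg_zero]

theorem isMomentForm_g2 : IsMomentForm g2.incl dot7 g2Map (repTraceForm (1 / 3) g2.incl) := by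
  refine isMomentForm_repTraceForm _ _ (fun x hx => Subtype.ext hx) (fun x hx => hx) ?_
  intro x u v
  -- Only the `formMap` term contributes, with trace `(3 / 2) * 2 * ⟨x u, v⟩`; hence the factor `1 /
  -- 3`.
  have e : x.1 * g2End u v =
      (1 / 2 : ℂ) • (x.1 * cross7 (cross7 u v)) + (3 / 2 : ℂ) • (x.1 * formMap dot7 u v) := by
    rw [← mul_smul_comm, ← mul_smul_comm, ← mul_add]
    rfl
  simp only [LieSubalgebra.coe_incl, coe_g2Map, e, map_add, map_smul, trace_mul_cross7,
    trace_mul_formMap, smul_eq_mul]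
  have h1 := g2_dot7 x v u
  rw [dot7_symm (x.1 u) v]
  linear_combination -(1 / 2 : ℂ) * h1

/-! ### The form for `F(4)` -/

theorem cliff_injective : Function.Injective cliff := by
  rw [injective_iff_map_eq_zero]
  intro p hp
  have := congrArg Prod.snd (LinearMap.congr_fun hp (1, 0))
  simpa [cliff_apply] using this

theorem spin_faithful (x : skewAdjointLieSubalgebra dot7) (hx : spin x = 0) : x = 0 := by
  refine Subtype.ext (LinearMap.ext fun p => cliff_injective ?_)
  rw [← spinEnd_cliff x p, ← spin_apply, hx]
  simp

/-- Since `[spin x, γ(p)] = γ(x p)`, the powers of `x` on `ℂ⁷` are read off from the powers of `ad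
(spin x)`, which is nilpotent. -/
theorem isNilpotent_of_isNilpotent_spin (x : skewAdjointLieSubalgebra dot7)
    (hx : IsNilpotent (spin x)) : IsNilpotent x.1 := by
  have hpow : ∀ (k : ℕ) (p : Fin 7 → ℂ), cliff ((x.1 ^ k) p) =
      (LieAlgebra.ad ℂ (Module.End ℂ (ℂ × (Fin 7 → ℂ))) (spin x) ^ k) (cliff p) := by
    intro k p
    induction k with
    | zero => rfl
    | succ k ih =>
      rw [pow_succ', pow_succ', Module.End.mul_apply, Module.End.mul_apply, ← ih,
        ← spinEnd_cliff x]
      rfl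
  obtain ⟨N, hN⟩ := LieAlgebra.ad_nilpotent_of_nilpotent (R := ℂ) hx
  refine ⟨N, LinearMap.ext fun p => cliff_injective ?_⟩
  rw [hpow, hN]
  simp

/-- The trace on `ℂ⁷` sums `-(2 / 3) ⟨γ(x e_j) γ(e_j) u, v⟩` over `j`. The sum of the Clifford
products is `-4 spin x`, so the trace is `(8 / 3) ⟨spin x u, v⟩`, and `3 / 8` normalizes it. -/
theorem isMomentForm_spin : IsMomentForm spin dot8 spinPair
    (repTraceForm (3 / 8) (skewAdjointLieSubalgebra dot7).incl) := by
  refine isMomentForm_repTraceForm _ _ spin_faithful isNilpotent_of_isNilpotent_spin ?_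
  intro x u v
  have e : ∀ j : Fin 7, dot7 ((x.1 * spinPairEnd u v) (Pi.single j 1)) (Pi.single j 1) =
      -(2 / 3 : ℂ) * dot8 ((cliff (x.1 (Pi.single j 1)) * cliff (Pi.single j 1)) u) v := by
    intro j
    have h1 := skewAdjoint_apply dot7 x (spinPairEnd u v (Pi.single j 1)) (Pi.single j 1)
    -- A skew-adjoint `x` has zero diagonal entries, which removes the term `⟨u, v⟩ p` of
    -- `spinPairEnd`.
    have h2 := skewAdjoint_apply dot7 x (Pi.single j 1) (Pi.single j 1)
    rw [dot7_symm (Pi.single j 1)] at h2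
    have h3 : dot7 (spinPairEnd u v (Pi.single j 1)) (x.1 (Pi.single j 1)) =
        (2 / 3 : ℂ) * (dot8 (cliff (x.1 (Pi.single j 1)) (cliff (Pi.single j 1) u)) v +
          dot8 u v * dot7 (x.1 (Pi.single j 1)) (Pi.single j 1)) := by
      rw [dot7_symm, spinPairEnd_apply, map_smul, map_add, map_smul, dot7_spinVec, smul_eq_mul,
        smul_eq_mul]
    rw [Module.End.mul_apply, Module.End.mul_apply]
    linear_combination h1 - h3 - (1 / 3 : ℂ) * dot8 u v * h2
  simp only [LieSubalgebra.coe_incl, coe_spinPair]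
  rw [trace_eq_sum_dot7, Finset.sum_congr rfl fun j _ => e j, spin_apply, spinEnd_apply]
  simp only [LinearMap.smul_apply, LinearMap.sum_apply, map_smul, map_sum, smul_eq_mul,
    ← Finset.mul_sum]
  ring

/-! ### Nondegeneracy -/

theorem nondegenerate_symplecticForm : symplecticForm.Nondegenerate := by
  refine LinearMap.BilinForm.Nondegenerate.ofSeparatingLeft fun u hu => ?_
  have h0 := hu (Pi.single 0 1)
  have h1 := hu (Pi.single 1 1)
  simp at h0 h1
  ext i
  fin_cases i <;> simp [h0, h1]

theorem nondegenerate_dot7 : dot7.Nondegenerate := by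
  refine LinearMap.BilinForm.Nondegenerate.ofSeparatingLeft fun u hu => ?_
  refine dot7_ext fun p => ?_
  rw [dot7_symm, hu, map_zero]

theorem nondegenerate_dot8 : dot8.Nondegenerate := by
  refine LinearMap.BilinForm.Nondegenerate.ofSeparatingLeft fun a ha => ?_
  refine Prod.ext ?_ (nondegenerate_dot7.1 _ fun p => ?_)
  · simpa [dot8_apply] using ha (1, 0)
  · simpa [dot8_apply] using ha (0, p)

instance : FiniteDimensional ℂ g2 := inferInstanceAs (FiniteDimensional ℂ g2.toSubmodule)

instance {V : Type*} [AddCommGroup V] [Module ℂ V] [FiniteDimensional ℂ V]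
    (ψ : LinearMap.BilinForm ℂ V) : FiniteDimensional ℂ (skewAdjointLieSubalgebra ψ) :=
  inferInstanceAs (FiniteDimensional ℂ (skewAdjointLieSubalgebra ψ).toSubmodule)

/-! ### The rank formula and the three families -/

theorem LieSuperData.prime_and_formRank_of_hasJordanType {𝔨₁ 𝔨₂ V₁ V₂ : Type*} [LieRing 𝔨₁]
    [LieAlgebra ℂ 𝔨₁] [FiniteDimensional ℂ 𝔨₁] [LieRing 𝔨₂] [LieAlgebra ℂ 𝔨₂]
    [FiniteDimensional ℂ 𝔨₂] [AddCommGroup V₁] [Module ℂ V₁] [FiniteDimensional ℂ V₁]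
    [AddCommGroup V₂] [Module ℂ V₂] [FiniteDimensional ℂ V₂] (D : LieSuperData 𝔨₁ 𝔨₂ V₁ V₂)
    {τ₁ : LinearMap.BilinForm ℂ 𝔨₁} {τ₂ : LinearMap.BilinForm ℂ 𝔨₂}
    (h₁ : IsMomentForm D.ρ₁ D.ψ₁ D.π₁ τ₁) (h₂ : IsMomentForm D.ρ₂ D.ψ₂ D.π₂ τ₂)
    (hψ₁ : D.ψ₁.Nondegenerate) (hψ₂ : D.ψ₂.Nondegenerate)
    {Φ : LinearMap.BilinForm ℂ (𝔨₁ × 𝔨₂)} (hΦ : Φ.lieInvariant (𝔨₁ × 𝔨₂)) (hΦ' : Φ.Nondegenerate)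
    {m n : ℕ} {μ : m.Partition} {ν : n.Partition}
    {x : 𝔨₁} {y : 𝔨₂} (hx : HasJordanType (D.ρ₁ x) μ) (hy : HasJordanType (D.ρ₂ y) ν)
    {ι : Type*} [Fintype ι] (v : Module.Basis ι ℂ (V₁ ⊗[ℂ] V₂)) :
    (idealOfSet Φ (adjointOrbit (x, y))).IsPrime ∧
      (D.toLieSuperalgebra.formRank v (idealOfSet Φ (adjointOrbit (x, y))) : ℤ) =
        Module.finrank ℂ (V₁ ⊗[ℂ] V₂) -
          ∑ i ∈ Finset.Icc 1 m, (μ.dualPart i * ν.dualPart i : ℤ) := by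
  obtain ⟨hp, hr⟩ := D.prime_and_formRank h₁ h₂ hψ₁ hψ₂ hΦ hΦ' hx.isNilpotent hy.isNilpotent v
  exact ⟨hp, by rw [hr]; exact finrank_range_tensor hx hy⟩

theorem theorem3p7 :
    -- `osp(m, n)`, where `m = dim V₁ ≥ 3` and `n = dim V₂`
    (∀ (V₁ V₂ : Type*) [AddCommGroup V₁] [Module ℂ V₁] [FiniteDimensional ℂ V₁]
      [AddCommGroup V₂] [Module ℂ V₂] [FiniteDimensional ℂ V₂]
      (ψ₁ : LinearMap.BilinForm ℂ V₁) (ψ₂ : LinearMap.BilinForm ℂ V₂)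
      (h₁ : ∀ u v, ψ₁ u v = ψ₁ v u) (h₂ : ∀ u v, ψ₂ u v = -ψ₂ v u)
      (_ : ψ₁.Nondegenerate) (_ : ψ₂.Nondegenerate) (_ : 3 ≤ Module.finrank ℂ V₁)
      -- the form that identifies `𝔤₀` with its dual
      (Φ : LinearMap.BilinForm ℂ (skewAdjointLieSubalgebra ψ₁ × skewAdjointLieSubalgebra ψ₂))
      (_ : Φ.lieInvariant (skewAdjointLieSubalgebra ψ₁ × skewAdjointLieSubalgebra ψ₂))
      (_ : Φ.Nondegenerate)
      -- the orbit of `(x, y)` with the Jordan types `μ`, `ν`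
      (μ : (Module.finrank ℂ V₁).Partition) (ν : (Module.finrank ℂ V₂).Partition)
      (x : skewAdjointLieSubalgebra ψ₁) (y : skewAdjointLieSubalgebra ψ₂)
      (_ : HasJordanType (x : Module.End ℂ V₁) μ) (_ : HasJordanType (y : Module.End ℂ V₂) ν)
      (ι : Type*) [Fintype ι] (v : Module.Basis ι ℂ (V₁ ⊗[ℂ] V₂)),
      (idealOfSet Φ (adjointOrbit (x, y))).IsPrime ∧
      ((osp ψ₁ ψ₂ h₁ h₂).toLieSuperalgebra.formRank v (idealOfSet Φ (adjointOrbit (x, y))) : ℤ) =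
        Module.finrank ℂ (V₁ ⊗[ℂ] V₂) -
          ∑ i ∈ Finset.Icc 1 (Module.finrank ℂ V₁), (μ.dualPart i * ν.dualPart i : ℤ)) ∧
    -- `G(3)`
    (∀ (Φ : LinearMap.BilinForm ℂ (g2 × skewAdjointLieSubalgebra symplecticForm))
      (_ : Φ.lieInvariant (g2 × skewAdjointLieSubalgebra symplecticForm))
      (_ : Φ.Nondegenerate)
      (μ : Nat.Partition 7) (ν : Nat.Partition 2)
      (x : g2) (y : skewAdjointLieSubalgebra symplecticForm)
      (_ : HasJordanType (x : Module.End ℂ (Fin 7 → ℂ)) μ)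
      (_ : HasJordanType (y : Module.End ℂ (Fin 2 → ℂ)) ν)
      (ι : Type*) [Fintype ι] (v : Module.Basis ι ℂ ((Fin 7 → ℂ) ⊗[ℂ] (Fin 2 → ℂ))),
      (idealOfSet Φ (adjointOrbit (x, y))).IsPrime ∧
      (G3.toLieSuperalgebra.formRank v (idealOfSet Φ (adjointOrbit (x, y))) : ℤ) =
        Module.finrank ℂ ((Fin 7 → ℂ) ⊗[ℂ] (Fin 2 → ℂ)) -
          ∑ i ∈ Finset.Icc 1 7, (μ.dualPart i * ν.dualPart i : ℤ)) ∧
    -- `F(4)`, where the Jordan type of `x ∈ so(7)` is taken on the spin representation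
    (∀ (Φ : LinearMap.BilinForm ℂ
        (skewAdjointLieSubalgebra dot7 × skewAdjointLieSubalgebra symplecticForm))
      (_ : Φ.lieInvariant
        (skewAdjointLieSubalgebra dot7 × skewAdjointLieSubalgebra symplecticForm))
      (_ : Φ.Nondegenerate)
      (μ : Nat.Partition 8) (ν : Nat.Partition 2)
      (x : skewAdjointLieSubalgebra dot7) (y : skewAdjointLieSubalgebra symplecticForm)
      (_ : HasJordanType (spin x) μ) (_ : HasJordanType (y : Module.End ℂ (Fin 2 → ℂ)) ν)
      (ι : Type*) [Fintype ι] (v : Module.Basis ι ℂ ((ℂ × (Fin 7 → ℂ)) ⊗[ℂ] (Fin 2 → ℂ))),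
      (idealOfSet Φ (adjointOrbit (x, y))).IsPrime ∧
      (F4.toLieSuperalgebra.formRank v (idealOfSet Φ (adjointOrbit (x, y))) : ℤ) =
        Module.finrank ℂ ((ℂ × (Fin 7 → ℂ)) ⊗[ℂ] (Fin 2 → ℂ)) -
          ∑ i ∈ Finset.Icc 1 8, (μ.dualPart i * ν.dualPart i : ℤ)) := by
  refine ⟨?_, ?_, ?_⟩
  · intro V₁ V₂ _ _ _ _ _ _ ψ₁ ψ₂ h₁ h₂ hψ₁ hψ₂ _ Φ hΦ hΦ' μ ν x y hx hy ι _ v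
    exact (osp ψ₁ ψ₂ h₁ h₂).prime_and_formRank_of_hasJordanType 
      (isMomentForm_skewMap (ε := 1) (by norm_num) (by simpa using h₁))
      (isMomentForm_skewMap (ε := -1) (by norm_num) (by simpa using h₂)) hψ₁ hψ₂ hΦ hΦ' hx hy v
  · intro Φ hΦ hΦ' μ ν x y hx hy ι _ v
    exact G3.prime_and_formRank_of_hasJordanType isMomentForm_g2
      (isMomentForm_skewMap (ε := -1) (by norm_num) (by simpa using symplecticForm_skew))
      nondegenerate_dot7 nondegenerate_symplecticForm hΦ hΦ' hx hy v
  · intro Φ hΦ hΦ' μ ν x y hx hy ι _ v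
    exact F4.prime_and_formRank_of_hasJordanType isMomentForm_spin
      (isMomentForm_skewMap (ε := -1) (by norm_num) (by simpa using symplecticForm_skew))
      nondegenerate_dot8 nondegenerate_symplecticForm hΦ hΦ' hx hy v
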